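/- Let $\Omega\subset\mathbf R^2$ be a connected open set with smooth boundary such that: $\Omega$ is invariant under $(x,y)\mapsto(x+1,y)$; the sets $\Omega_n:=\Omega\cap([n,n+1]\times\mathbf R)$, $n\in\mathbf Z$, are bounded; the points $(n,0)$ lie in $\Omega$; and the vertical lines $\{n\}\times\mathbf R$ are nowhere tangent to $\partial\Omega$. Let $u$ be an eigenfunction of the Neumann Laplacian on $\Omega_0$, i.e. there is $E\in\mathbf R$ such that $0\ne u\in H^1(\Omega_0)$ and $\int_{\Omega_0}\overline{\nabla v}\cdot\nabla u=E\int_{\Omega_0}\bar v\,u$ for all $v\in H^1(\Omega_0)$; $u$ denotes the representative that is continuous on $\Omega_0$ (which includes the vertical segments $\Omega\cap(\{0,1\}\times\mathbf R)$). For $\varepsilon>0$ and $\theta\in\mathbf R$ put \[ u_{\theta,\varepsilon}(y):=u(0,y)-e^{i\theta}u(1,y),\quad y\in[-\varepsilon,\varepsilon],\qquad \langle f,g\rangle:=\int_{-\varepsilon}^{\varepsilon}\overline{f(y)}\,g(y)\,dy, \] let $X_\varepsilon$ be the Hilbert space of functions $\varphi$ with $\|\varphi\|_{X_\varepsilon}^2:=\int_{-\varepsilon}^{\varepsilon}\sqrt{\varepsilon^2-y^2}\,|\varphi(y)|^2\,dy<\infty$,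 let $Y_\varepsilon:=\{\psi\in C[-\varepsilon,\varepsilon]:\psi'\in X_\varepsilon\}$ (weak derivative), and let $L_\varepsilon f(x):=\int_{-\varepsilon}^{\varepsilon}\log|x-y|\,f(y)\,dy$. Then there are constants $\varepsilon_0\in(0,1)$ and $C,A>0$, depending only on $\Omega$ and $u$, such that for all $\varepsilon\in(0,\varepsilon_0)$ the operator $L_\varepsilon$ is a bijection from $X_\varepsilon$ onto $Y_\varepsilon$, and for all $\theta\in\mathbf R$ one has $u_{\theta,\varepsilon}\in Y_\varepsilon$, \[ \Big|\langle L_\varepsilon^{-1}u_{\theta,\varepsilon},u_{\theta,\varepsilon}\rangle-\frac{|u_{\theta,\varepsilon}(0)|^2}{\log\varepsilon}\Big|\le\frac{C}{|\log\varepsilon|^2}, \] and, for every bounded linear operator $B$ on $X_\varepsilon$, \[ \big|\langle BL_\varepsilon^{-1}u_{\theta,\varepsilon},u_{\theta,\varepsilon}\rangle\big|\le\frac{A\,\|B\|_{L(X_\varepsilon,X_\varepsilon)}}{|\log\varepsilon|}. \] -/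

import Mathlib

open MeasureTheory Set Filter Topology
open scoped ContDiff ComplexConjugate

noncomputable section

namespace CrackedWaveguide

/-- `F` is a smooth local defining function of `Ω` at the point `p`: near `p` the set `Ω` is
`{F < 0}`, and the differential of `F` at `p` is nonzero. -/
structure IsDefiningFunctionAt (Ω : Set (ℝ × ℝ)) (F : ℝ × ℝ → ℝ) (p : ℝ × ℝ) : Prop where
  smooth : ContDiff ℝ ∞ F
  local_eq : ∀ᶠ q in 𝓝 p, q ∈ Ω ↔ F q < 0
  fderiv_ne_zero : fderiv ℝ F p ≠ 0

/-- Connected smooth planar domains that are invariant under the shift `(x, y) ↦ (x + 1, y)`, have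
bounded cells `Ω ∩ ([n, n+1] × ℝ)`, contain the points `(n, 0)`, and whose boundary is nowhere
tangent to the vertical lines `{n} × ℝ` (i.e. the direction `(0, 1)` is not in the kernel of the
differential of a defining function at boundary points lying on these lines). -/
structure IsWaveguide (Ω : Set (ℝ × ℝ)) : Prop where
  isOpen : IsOpen Ω
  isConnected : IsConnected Ω
  shift_mem_iff : ∀ x y : ℝ, (x + 1, y) ∈ Ω ↔ (x, y) ∈ Ω
  bounded_cell : ∀ n : ℤ, Bornology.IsBounded (Ω ∩ Icc (n : ℝ) (n + 1) ×ˢ univ)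
  window_mem : ∀ n : ℤ, ((n : ℝ), (0 : ℝ)) ∈ Ω
  smooth_boundary : ∀ p ∈ frontier Ω, ∃ F : ℝ × ℝ → ℝ, IsDefiningFunctionAt Ω F p
  non_tangent : ∀ p ∈ frontier Ω, (∃ n : ℤ, p.1 = n) →
    ∀ F : ℝ × ℝ → ℝ, IsDefiningFunctionAt Ω F p → fderiv ℝ F p (0, 1) ≠ 0

/-- The elementary cell `Ω ∩ ([0, 1] × ℝ)`; it contains the parts of the two vertical segments lying
in `Ω`. -/
def cell (Ω : Set (ℝ × ℝ)) : Set (ℝ × ℝ) := Ω ∩ Icc 0 1 ×ˢ univ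

/-- The open elementary cell `Ω ∩ ((0, 1) × ℝ)`. -/
def openCell (Ω : Set (ℝ × ℝ)) : Set (ℝ × ℝ) := Ω ∩ Ioo 0 1 ×ˢ univ

/-- `u` belongs to the Sobolev space `H¹(U)` and `(g₁, g₂)` is its weak gradient in `U`. -/
structure HasH1Gradient (U : Set (ℝ × ℝ)) (u g₁ g₂ : ℝ × ℝ → ℂ) : Prop where
  memLp : MemLp u 2 (volume.restrict U)
  memLp_fst : MemLp g₁ 2 (volume.restrict U)
  memLp_snd : MemLp g₂ 2 (volume.restrict U)
  weak_fst : ∀ φ : ℝ × ℝ → ℂ, ContDiff ℝ ∞ φ → HasCompactSupport φ → tsupport φ ⊆ U →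
    ∫ p in U, u p * fderiv ℝ φ p (1, 0) = -∫ p in U, g₁ p * φ p
  weak_snd : ∀ φ : ℝ × ℝ → ℂ, ContDiff ℝ ∞ φ → HasCompactSupport φ → tsupport φ ⊆ U →
    ∫ p in U, u p * fderiv ℝ φ p (0, 1) = -∫ p in U, g₂ p * φ p

/-- `u` is an eigenfunction, with eigenvalue `E`, of the Neumann Laplacian on `L²(U)`, the
self-adjoint operator of the form `∫ ∇v̄ · ∇u` with form domain `H¹(U)`. -/
def IsNeumannEigenfunction (U : Set (ℝ × ℝ)) (E : ℝ) (u : ℝ × ℝ → ℂ) : Prop :=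
  (¬ u =ᵐ[volume.restrict U] 0) ∧
  ∃ g₁ g₂ : ℝ × ℝ → ℂ, HasH1Gradient U u g₁ g₂ ∧
    ∀ v h₁ h₂ : ℝ × ℝ → ℂ, HasH1Gradient U v h₁ h₂ →
      ∫ p in U, (conj (h₁ p) * g₁ p + conj (h₂ p) * g₂ p) = E * ∫ p in U, conj (v p) * u p

/-- The measure `√(ε² - y²) dy` on `[-ε, ε]`. -/
def weightMeasure (ε : ℝ) : Measure ℝ :=
  (volume.restrict (Icc (-ε) ε)).withDensity fun y => ENNReal.ofReal (Real.sqrt (ε ^ 2 - y ^ 2))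

/-- The Hilbert space `X_ε` of functions with `∫_{-ε}^{ε} √(ε² - y²) |φ(y)|² dy < ∞`. -/
abbrev X (ε : ℝ) : Type := Lp ℂ 2 (weightMeasure ε)

/-- The space `Y_ε` of continuous functions on `[-ε, ε]` whose derivative lies in `X_ε`
(elements of `X_ε` are Lebesgue integrable on `[-ε, ε]`, so having the weak derivative `g ∈ X_ε`
means being a primitive of `g`). -/
def Y (ε : ℝ) : Set (Icc (-ε) ε → ℂ) :=
  {ψ | Continuous ψ ∧
    ∃ g : X ε, ∀ x y : Icc (-ε) ε, ψ y - ψ x = ∫ t in (x : ℝ)..(y : ℝ), g t}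

/-- The integral operator `L_ε` with kernel `log |x - y|` on `[-ε, ε]`. -/
def L (ε : ℝ) (f : X ε) : Icc (-ε) ε → ℂ :=
  fun x => ∫ y in (-ε)..ε, (Real.log |(x : ℝ) - y| : ℂ) * f y

/-- The inverse of `L_ε : X_ε → Y_ε`. It is meaningful when `L_ε` is a bijection onto `Y_ε`. -/
def Linv (ε : ℝ) (ψ : Icc (-ε) ε → ℂ) : X ε := Function.invFunOn (L ε) univ ψ

/-- The (unweighted) scalar product of `L²[-ε, ε]`, conjugate-linear in the first argument. -/
def pairing (ε : ℝ) (f g : ℝ → ℂ) : ℂ := ∫ y in (-ε)..ε, conj (f y) * g y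

/-- The function `u_θ(y) = u(0, y) - e^{iθ} u(1, y)`. -/
def uTheta (u : ℝ × ℝ → ℂ) (θ : ℝ) (y : ℝ) : ℂ :=
  u (0, y) - Complex.exp (Complex.I * θ) * u (1, y)

/-- The function `u_{θ,ε}`: the restriction of `u_θ` to `[-ε, ε]`. -/
def uThetaRestrict (u : ℝ × ℝ → ℂ) (θ ε : ℝ) : Icc (-ε) ε → ℂ := fun y => uTheta u θ y

end CrackedWaveguide

end

/-!
Testing the eigenvalue equation against a cutoff times `log (|p - (c, t)|² + δ²)`, whose normal
derivative vanishes on the flat part of the boundary in `x = c`, and letting `δ → 0` represents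
`u (c, t)` by an integral: the Laplacian of the test function is an approximate identity, half of
whose mass lies in the domain, plus a remainder whose integral is Lipschitz in `t`. Hence `u` is
Lipschitz along both windows, and so is `u_{θ,ε}`, with constants independent of `θ` and `ε`.

In `X ε` the normalized functions `T_n(y/ε) / √(ε² - y²)` and `U_n(y/ε)` form two orthonormal
bases. The logarithmic potential of the vector of `T₀` is the constant `√π log (ε / 2)`, while that
of the vector of `T_{n+1}` has derivative `-π` times the vector of `U_n`. So `L ε` is inverted by
the isometry `U_n ↦ T_{n+1}`, and for a Lipschitz function `ψ` the preimage `Linv ε ψ` is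
`ψ 0 / (√π log (ε / 2))` times the vector of `T₀`, up to an error `O(ε)`, negligible against
`|log ε|⁻²`.
-/

noncomputable section

namespace CrackedWaveguide

open scoped NNReal

section WeightedSpace

variable {ε C : ℝ} {E : Type*} [NormedAddCommGroup E] [NormedSpace ℝ E] {k : ℝ → ℂ}

/-- The weight `√(ε² - y²)` defining the norm of `X ε`. -/
def weight (ε y : ℝ) : ℝ := √(ε ^ 2 - y ^ 2)

lemma continuous_weight (ε : ℝ) : Continuous (weight ε) := by
  unfold weight; fun_prop

lemma measurable_ofReal_weight (ε : ℝ) : Measurable fun y => ENNReal.ofReal (weight ε y) :=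
  (continuous_weight ε).measurable.ennreal_ofReal

lemma weight_nonneg (ε y : ℝ) : 0 ≤ weight ε y := Real.sqrt_nonneg _

lemma weight_pos {y : ℝ} (hy : y ∈ Ioo (-ε) ε) : 0 < weight ε y :=
  Real.sqrt_pos.2 (by nlinarith [hy.1, hy.2])

lemma weight_eq_mul (hε : 0 < ε) (y : ℝ) : weight ε y = ε * √(1 - (y / ε) ^ 2) := by
  have h : ε ^ 2 - y ^ 2 = ε ^ 2 * (1 - (y / ε) ^ 2) := by field_simp
  rw [weight, h, Real.sqrt_mul (sq_nonneg ε), Real.sqrt_sq hε.le]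

lemma ae_weight_pos (ε : ℝ) : ∀ᵐ y ∂volume.restrict (Icc (-ε) ε), 0 < weight ε y := by
  rw [← restrict_Ioo_eq_restrict_Icc]
  filter_upwards [ae_restrict_mem measurableSet_Ioo] with y hy using weight_pos hy

lemma weightMeasure_absolutelyContinuous (ε : ℝ) :
    weightMeasure ε ≪ volume.restrict (Icc (-ε) ε) :=
  withDensity_absolutelyContinuous _ _

lemma absolutelyContinuous_weightMeasure (ε : ℝ) :
    volume.restrict (Icc (-ε) ε) ≪ weightMeasure ε := by
  refine withDensity_absolutelyContinuous' (measurable_ofReal_weight ε).aemeasurable ?_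
  filter_upwards [ae_weight_pos ε] with y hy
  simpa [weight] using hy

lemma integrable_weightMeasure_iff {h : ℝ → E} :
    Integrable h (weightMeasure ε) ↔ IntegrableOn (fun y => weight ε y • h y) (Icc (-ε) ε) := by
  change Integrable h ((volume.restrict (Icc (-ε) ε)).withDensity
    fun y => ENNReal.ofReal (weight ε y)) ↔ _
  rw [integrable_withDensity_iff_integrable_smul' (measurable_ofReal_weight ε) (by simp)]
  simp only [ENNReal.toReal_ofReal (weight_nonneg ε _), IntegrableOn]

lemma integral_weightMeasure (h : ℝ → E) :
    ∫ y, h y ∂weightMeasure ε = ∫ y in Icc (-ε) ε, weight ε y • h y := by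
  change ∫ y, h y ∂((volume.restrict (Icc (-ε) ε)).withDensity
    fun y => ENNReal.ofReal (weight ε y)) = _
  rw [integral_withDensity_eq_integral_toReal_smul (measurable_ofReal_weight ε) (by simp)]
  simp only [ENNReal.toReal_ofReal (weight_nonneg ε _)]

instance isFiniteMeasure_weightMeasure (ε : ℝ) : IsFiniteMeasure (weightMeasure ε) := by
  have h : Integrable (fun _ : ℝ => (1 : ℝ)) (weightMeasure ε) :=
    integrable_weightMeasure_iff.2
      (((continuous_weight ε).smul continuous_const).continuousOn.integrableOn_compact
        isCompact_Icc)
  exact (integrable_const_iff_isFiniteMeasure one_ne_zero).1 h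

lemma weightMeasure_real_univ_le (hε : 0 ≤ ε) : (weightMeasure ε).real univ ≤ 2 * ε ^ 2 := by
  have hw : ∀ y, weight ε y ≤ ε := fun y =>
    (Real.sqrt_le_left hε).2 (by nlinarith [sq_nonneg y])
  calc (weightMeasure ε).real univ = ∫ y in Icc (-ε) ε, weight ε y := by
        simpa using integral_weightMeasure (ε := ε) (fun _ => (1 : ℝ))
    _ ≤ ∫ _ in Icc (-ε) ε, ε := by
        refine integral_mono ?_ (integrable_const _) hw
        exact (continuous_weight ε).continuousOn.integrableOn_compact isCompact_Icc
    _ = 2 * ε ^ 2 := by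
        rw [setIntegral_const, Real.volume_real_Icc_of_le (by linarith), smul_eq_mul]
        ring

lemma integral_div_weight (hε : 0 < ε) (h : ℝ → ℝ) :
    ∫ y in Icc (-ε) ε, h (y / ε) / weight ε y = ∫ z, h z ∂Polynomial.Chebyshev.measureT := by
  have hsub := intervalIntegral.integral_comp_div (a := -ε) (b := ε)
    (fun z => h z * √(1 - z ^ 2)⁻¹) hε.ne'
  rw [neg_div, div_self hε.ne', ← inv_smul_eq_iff₀ hε.ne', ← intervalIntegral.integral_smul]
    at hsub
  rw [Polynomial.Chebyshev.integral_measureT, ← hsub,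
    intervalIntegral.integral_of_le (by linarith), integral_Icc_eq_integral_Ioc]
  refine integral_congr_ae (Eventually.of_forall fun y => ?_)
  simp only [weight_eq_mul hε, Real.sqrt_inv, smul_eq_mul, div_eq_mul_inv, mul_inv]
  ring

lemma integral_inv_weight (hε : 0 < ε) : ∫ y in Icc (-ε) ε, (weight ε y)⁻¹ = Real.pi := by
  simpa using (integral_div_weight hε fun _ => 1).trans
    (by simpa using Polynomial.Chebyshev.integral_eval_T_real_measureT_zero)

lemma integrableOn_inv_weight (hε : 0 < ε) :
    IntegrableOn (fun y => (weight ε y)⁻¹) (Icc (-ε) ε) :=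
  Integrable.of_integral_ne_zero ((integral_inv_weight hε).trans_ne Real.pi_ne_zero)

lemma integrableOn_norm_sq_div_weight (hε : 0 < ε)
    (hk : AEStronglyMeasurable k (volume.restrict (Icc (-ε) ε)))
    (hC : ∀ y ∈ Icc (-ε) ε, ‖k y‖ ≤ C) :
    IntegrableOn (fun y => ‖k y‖ ^ 2 / weight ε y) (Icc (-ε) ε) := by
  refine (integrableOn_inv_weight hε).bdd_mul (c := C ^ 2) (hk.norm.pow 2) ?_
  filter_upwards [ae_restrict_mem measurableSet_Icc] with y hy
  rw [norm_pow, norm_norm]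
  gcongr
  exact hC y hy

lemma memLp_div_weight (hε : 0 < ε)
    (hk : AEStronglyMeasurable k (volume.restrict (Icc (-ε) ε)))
    (hC : ∀ y ∈ Icc (-ε) ε, ‖k y‖ ≤ C) :
    MemLp (fun y => k y / weight ε y) 2 (weightMeasure ε) := by
  have hm : AEStronglyMeasurable (fun y => k y / weight ε y) (volume.restrict (Icc (-ε) ε)) :=
    (hk.aemeasurable.div (Complex.continuous_ofReal.comp
      (continuous_weight ε)).measurable.aemeasurable).aestronglyMeasurable
  rw [memLp_two_iff_integrable_sq_norm (hm.mono_ac (weightMeasure_absolutelyContinuous ε)),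
    integrable_weightMeasure_iff]
  refine (integrableOn_norm_sq_div_weight hε hk hC).congr ?_
  filter_upwards [ae_weight_pos ε] with y hy
  rw [norm_div, Complex.norm_real, Real.norm_of_nonneg hy.le, smul_eq_mul]
  field_simp

/-- The element `k / √(ε² - y²)` of `X ε`. It is the Riesz representative of the functional
`f ↦ ∫ k̄ f`, which turns unweighted integrals against elements of `X ε` into inner products. -/
def divWeight (k : ℝ → ℂ) (hk : MemLp (fun y => k y / weight ε y) 2 (weightMeasure ε)) : X ε :=
  hk.toLp _

lemma coeFn_divWeight (hk : MemLp (fun y => k y / weight ε y) 2 (weightMeasure ε)) :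
    ⇑(divWeight k hk) =ᵐ[volume.restrict (Icc (-ε) ε)] fun y => k y / weight ε y :=
  (absolutelyContinuous_weightMeasure ε).ae_le hk.coeFn_toLp

lemma inner_ae_eq_of_ae_eq_div_weight {F : X ε}
    (hF : ⇑F =ᵐ[volume.restrict (Icc (-ε) ε)] fun y => k y / weight ε y) (f : X ε) :
    (fun y => weight ε y • inner ℂ (F y) (f y)) =ᵐ[volume.restrict (Icc (-ε) ε)]
      fun y => conj (k y) * f y := by
  filter_upwards [hF, ae_weight_pos ε] with y hy hw
  have hw' : (weight ε y : ℂ) ≠ 0 := by exact_mod_cast hw.ne'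
  rw [hy, RCLike.inner_apply, map_div₀, Complex.conj_ofReal, Complex.real_smul]
  field_simp

lemma inner_eq_setIntegral_of_ae_eq_div_weight {F : X ε}
    (hF : ⇑F =ᵐ[volume.restrict (Icc (-ε) ε)] fun y => k y / weight ε y) (f : X ε) :
    inner ℂ F f = ∫ y in Icc (-ε) ε, conj (k y) * f y := by
  rw [L2.inner_def, integral_weightMeasure]
  exact integral_congr_ae (inner_ae_eq_of_ae_eq_div_weight hF f)

lemma integrableOn_conj_mul_of_ae_eq_div_weight {F : X ε}
    (hF : ⇑F =ᵐ[volume.restrict (Icc (-ε) ε)] fun y => k y / weight ε y) (f : X ε) :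
    IntegrableOn (fun y => conj (k y) * f y) (Icc (-ε) ε) :=
  (integrable_weightMeasure_iff.1 (L2.integrable_inner (𝕜 := ℂ) F f)).congr
    (inner_ae_eq_of_ae_eq_div_weight hF f)

lemma inner_divWeight_left (hk : MemLp (fun y => k y / weight ε y) 2 (weightMeasure ε))
    (f : X ε) : inner ℂ (divWeight k hk) f = ∫ y in Icc (-ε) ε, conj (k y) * f y :=
  inner_eq_setIntegral_of_ae_eq_div_weight (coeFn_divWeight hk) f

lemma integrableOn_coeFn (hε : 0 < ε) (f : X ε) : IntegrableOn f (Icc (-ε) ε) := by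
  simpa using integrableOn_conj_mul_of_ae_eq_div_weight (coeFn_divWeight
    (memLp_div_weight (k := 1) (C := 1) hε aestronglyMeasurable_const (by simp))) f

lemma norm_divWeight_le (hε : 0 < ε)
    (hk : AEStronglyMeasurable k (volume.restrict (Icc (-ε) ε)))
    (hC : ∀ y ∈ Icc (-ε) ε, ‖k y‖ ≤ C) :
    ‖divWeight k (memLp_div_weight hε hk hC)‖ ≤ C * √Real.pi := by
  have hC0 : 0 ≤ C := (norm_nonneg _).trans (hC 0 ⟨by linarith, hε.le⟩)
  refine le_of_sq_le_sq ?_ (by positivity)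
  rw [mul_pow, Real.sq_sqrt Real.pi_pos.le]
  have hnorm : ‖divWeight k (memLp_div_weight hε hk hC)‖ ^ 2
      = ∫ y in Icc (-ε) ε, ‖k y‖ ^ 2 / weight ε y := by
    rw [← Complex.ofReal_inj, ← integral_complex_ofReal, Complex.ofReal_pow]
    refine (inner_self_eq_norm_sq_to_K (𝕜 := ℂ) (divWeight k _)).symm.trans ?_
    rw [inner_divWeight_left]
    refine integral_congr_ae ?_
    filter_upwards [coeFn_divWeight (memLp_div_weight hε hk hC)] with y hy
    rw [hy, ← mul_div_assoc, Complex.conj_mul']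
    norm_cast
  calc ‖divWeight k (memLp_div_weight hε hk hC)‖ ^ 2
      = ∫ y in Icc (-ε) ε, ‖k y‖ ^ 2 / weight ε y := hnorm
    _ ≤ ∫ y in Icc (-ε) ε, C ^ 2 * (weight ε y)⁻¹ := by
        refine setIntegral_mono_on (integrableOn_norm_sq_div_weight hε hk hC)
          ((integrableOn_inv_weight hε).const_mul _) measurableSet_Icc fun y hy => ?_
        rw [div_eq_mul_inv]
        have := weight_nonneg ε y
        gcongr
        exact hC y hy
    _ = C ^ 2 * Real.pi := by rw [integral_const_mul, integral_inv_weight hε]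

end WeightedSpace

section PolynomialDensity

variable {E : Type*} [NormedAddCommGroup E] [NormedSpace ℝ E] {a b : ℝ} {h : ℝ → E}

lemma setIntegral_smul_eq_zero_of_forall_polynomial (hh : IntegrableOn h (Icc a b))
    (h0 : ∀ p : Polynomial ℝ, ∫ y in Icc a b, p.eval y • h y = 0) {φ : ℝ → ℝ}
    (hφ : ContinuousOn φ (Icc a b)) : ∫ y in Icc a b, φ y • h y = 0 := by
  rw [← norm_le_zero_iff]
  refine le_of_forall_pos_le_add fun δ hδ => ?_
  set N : ℝ := ∫ y in Icc a b, ‖h y‖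
  have : 0 ≤ N := integral_nonneg fun _ => norm_nonneg _
  obtain ⟨p, hp⟩ := exists_polynomial_near_of_continuousOn a b φ hφ (δ / (N + 1)) (by positivity)
  have hsub : ∫ y in Icc a b, φ y • h y = ∫ y in Icc a b, (φ y - p.eval y) • h y := by
    simp only [sub_smul]
    rw [integral_sub (hh.continuousOn_smul hφ isCompact_Icc)
      (hh.continuousOn_smul p.continuous.continuousOn isCompact_Icc), h0 p, sub_zero]
  calc ‖∫ y in Icc a b, φ y • h y‖
      ≤ ∫ y in Icc a b, δ / (N + 1) * ‖h y‖ := by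
        rw [hsub]
        refine norm_integral_le_of_norm_le (hh.norm.const_mul _) ?_
        filter_upwards [ae_restrict_mem measurableSet_Icc] with y hy
        rw [norm_smul, Real.norm_eq_abs, abs_sub_comm]
        gcongr
        exact (hp y hy).le
    _ = δ / (N + 1) * N := integral_const_mul _ _
    _ ≤ 0 + δ := by
        rw [div_mul_eq_mul_div, div_le_iff₀ (by positivity)]
        nlinarith

lemma ae_eq_zero_of_forall_polynomial [CompleteSpace E] (hh : IntegrableOn h (Icc a b))
    (h0 : ∀ p : Polynomial ℝ, ∫ y in Icc a b, p.eval y • h y = 0) :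
    h =ᵐ[volume.restrict (Icc a b)] 0 := by
  have hind : Integrable ((Icc a b).indicator h) :=
    (integrable_indicator_iff measurableSet_Icc).2 hh
  have hzero := ae_eq_zero_of_integral_contDiff_smul_eq_zero hind.locallyIntegrable
    fun g hg _ => by
      simp_rw [← indicator_smul_apply]
      rw [integral_indicator measurableSet_Icc]
      exact setIntegral_smul_eq_zero_of_forall_polynomial hh h0 hg.continuous.continuousOn
  rw [EventuallyEq, ae_restrict_iff' measurableSet_Icc]
  filter_upwards [hzero] with y hy hmem
  simpa [hmem] using hy

lemma ae_eq_zero_of_forall_polynomialSequence [CompleteSpace E] {c : ℝ} (hc : c ≠ 0)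
    (hh : IntegrableOn h (Icc a b)) (S : Polynomial.Sequence ℝ)
    (h0 : ∀ n, ∫ y in Icc a b, (S n).eval (y / c) • h y = 0) :
    h =ᵐ[volume.restrict (Icc a b)] 0 := by
  have hint (p : Polynomial ℝ) : IntegrableOn (fun y => p.eval (y / c) • h y) (Icc a b) :=
    hh.continuousOn_smul (p.continuous.comp (continuous_id.div_const c)).continuousOn isCompact_Icc
  have hspan (p : Polynomial ℝ) : ∫ y in Icc a b, p.eval (y / c) • h y = 0 := by
    have hp : p ∈ Submodule.span ℝ (range S) := by
      rw [S.span fun i => (Polynomial.leadingCoeff_ne_zero.2 (S.ne_zero i)).isUnit]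
      exact Submodule.mem_top
    induction hp using Submodule.span_induction with
    | mem p hp =>
      obtain ⟨n, rfl⟩ := hp
      exact h0 n
    | zero => simp
    | add p q _ _ hp hq =>
      simp only [Polynomial.eval_add, add_smul]
      rw [integral_add (hint p) (hint q), hp, hq, add_zero]
    | smul r p _ hp =>
      simp only [Polynomial.eval_smul, smul_eq_mul, mul_smul]
      rw [integral_smul, hp, smul_zero]
  refine ae_eq_zero_of_forall_polynomial hh fun p => ?_
  have hscale (y : ℝ) : (p.comp (Polynomial.C c * Polynomial.X)).eval (y / c) = p.eval y := by
    rw [Polynomial.eval_comp, Polynomial.eval_C_mul, Polynomial.eval_X, mul_div_cancel₀ _ hc]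
  have hcomp := hspan (p.comp (Polynomial.C c * Polynomial.X))
  simp_rw [hscale] at hcomp
  exact hcomp

end PolynomialDensity

open Polynomial.Chebyshev (T U measureT chebyshevTsequence)

section ChebyshevLift

variable {ε : ℝ} {p q : ℝ → ℝ}

lemma memLp_comp_div_weight (hε : 0 < ε) (hp : Continuous p) :
    MemLp (fun y => (p (y / ε) : ℂ) / weight ε y) 2 (weightMeasure ε) := by
  have hk : Continuous fun y => (p (y / ε) : ℂ) := by fun_prop
  obtain ⟨C, hC⟩ := isCompact_Icc.exists_bound_of_continuousOn (s := Icc (-ε) ε) hk.continuousOn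
  exact memLp_div_weight hε hk.aestronglyMeasurable hC

/-- The element `p(y/ε) / √(ε² - y²)` of `X ε`. This realizes `L²(dz / √(1 - z²))`, the space of
the Chebyshev polynomials of the first kind, inside `X ε`. -/
def chebyshevLift (hε : 0 < ε) (hp : Continuous p) : X ε :=
  divWeight (fun y => (p (y / ε) : ℂ)) (memLp_comp_div_weight hε hp)

lemma coeFn_chebyshevLift (hε : 0 < ε) (hp : Continuous p) :
    ⇑(chebyshevLift hε hp) =ᵐ[volume.restrict (Icc (-ε) ε)]
      fun y => ((p (y / ε) / weight ε y : ℝ) : ℂ) := by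
  simpa only [chebyshevLift, Complex.ofReal_div] using coeFn_divWeight (memLp_comp_div_weight hε hp)

lemma inner_chebyshevLift_left (hε : 0 < ε) (hp : Continuous p) (f : X ε) :
    inner ℂ (chebyshevLift hε hp) f = ∫ y in Icc (-ε) ε, p (y / ε) • f y := by
  simp only [chebyshevLift, inner_divWeight_left, Complex.conj_ofReal, Complex.real_smul]

lemma inner_chebyshevLift_chebyshevLift (hε : 0 < ε) (hp : Continuous p) (hq : Continuous q) :
    inner ℂ (chebyshevLift hε hp) (chebyshevLift hε hq)
      = ((∫ z, p z * q z ∂measureT : ℝ) : ℂ) := by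
  rw [inner_chebyshevLift_left, ← integral_div_weight hε, ← integral_complex_ofReal]
  refine integral_congr_ae ?_
  filter_upwards [coeFn_chebyshevLift hε hq] with y hy
  rw [hy, Complex.real_smul]
  push_cast
  ring

lemma orthonormal_chebyshevLift (hε : 0 < ε) {P : ℕ → ℝ → ℝ} (hP : ∀ n, Continuous (P n))
    (h : ∀ m n, ∫ z, P m z * P n z ∂measureT = if m = n then 1 else 0) :
    Orthonormal ℂ fun n => chebyshevLift hε (hP n) := by
  rw [orthonormal_iff_ite]
  intro m n
  rw [inner_chebyshevLift_chebyshevLift, h]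
  split_ifs <;> simp

end ChebyshevLift

section FirstKind

variable {ε : ℝ}

/-- The normalization constant of `T_n` in `L²(dz / √(1 - z²))`. -/
def normT (n : ℕ) : ℝ := if n = 0 then (√Real.pi)⁻¹ else √(2 / Real.pi)

lemma normT_zero : normT 0 = (√Real.pi)⁻¹ := if_pos rfl

lemma normT_of_ne_zero {n : ℕ} (hn : n ≠ 0) : normT n = √(2 / Real.pi) := if_neg hn

lemma normT_pos (n : ℕ) : 0 < normT n := by
  have := Real.pi_pos
  unfold normT
  split_ifs <;> positivity

/-- The Chebyshev polynomial `T_n`, normalized in `L²(dz / √(1 - z²))`. -/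
def orthoT (n : ℕ) (z : ℝ) : ℝ := normT n * (T ℝ n).eval z

@[fun_prop]
lemma continuous_orthoT (n : ℕ) : Continuous (orthoT n) :=
  continuous_const.mul (Polynomial.continuous _)

lemma orthoT_zero (z : ℝ) : orthoT 0 z = (√Real.pi)⁻¹ := by
  simp [orthoT, normT_zero]

lemma normT_le_one (n : ℕ) : normT n ≤ 1 := by
  have hpi := Real.pi_gt_three
  unfold normT
  split_ifs
  · exact inv_le_one_of_one_le₀ (Real.one_le_sqrt.2 (by linarith))
  · exact Real.sqrt_le_one.2 ((div_le_one Real.pi_pos).2 (by linarith))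

lemma abs_orthoT_le_one (n : ℕ) {z : ℝ} (hz : |z| ≤ 1) : |orthoT n z| ≤ 1 := by
  rw [orthoT, abs_mul, abs_of_pos (normT_pos n)]
  exact mul_le_one₀ (normT_le_one n) (abs_nonneg _)
    (Polynomial.Chebyshev.abs_eval_T_real_le_one n hz)

lemma integral_orthoT_mul_orthoT (m n : ℕ) :
    ∫ z, orthoT m z * orthoT n z ∂measureT = if m = n then 1 else 0 := by
  have hpi := Real.pi_pos
  simp only [orthoT, mul_mul_mul_comm, integral_const_mul]
  rcases eq_or_ne m n with rfl | h
  · rw [if_pos rfl]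
    rcases eq_or_ne m 0 with rfl | hm
    · rw [Nat.cast_zero, Polynomial.Chebyshev.integral_eval_T_real_mul_self_measureT_zero,
        normT_zero, ← mul_inv, Real.mul_self_sqrt hpi.le, inv_mul_cancel₀ hpi.ne']
    · rw [Polynomial.Chebyshev.integral_T_real_mul_self_measureT_of_ne_zero hm,
        normT_of_ne_zero hm, Real.mul_self_sqrt (by positivity)]
      field_simp
  · rw [if_neg h, Polynomial.Chebyshev.integral_eval_T_real_mul_eval_T_real_measureT_of_ne h,
      mul_zero]

/-- The orthonormal functions `T_n(y/ε) / √(ε² - y²)` of `X ε`, up to normalization. -/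
def vecT (hε : 0 < ε) (n : ℕ) : X ε := chebyshevLift hε (continuous_orthoT n)

lemma inner_vecT_left (hε : 0 < ε) (n : ℕ) (f : X ε) :
    inner ℂ (vecT hε n) f = ∫ y in Icc (-ε) ε, orthoT n (y / ε) • f y :=
  inner_chebyshevLift_left hε _ f

lemma orthonormal_vecT (hε : 0 < ε) : Orthonormal ℂ (vecT hε) :=
  orthonormal_chebyshevLift hε continuous_orthoT integral_orthoT_mul_orthoT

lemma orthogonal_span_vecT (hε : 0 < ε) : (Submodule.span ℂ (range (vecT hε)))ᗮ = ⊥ := by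
  rw [Submodule.eq_bot_iff]
  intro f hf
  have h0 (n : ℕ) : ∫ y in Icc (-ε) ε, (chebyshevTsequence ℝ n).eval (y / ε) • f y = 0 := by
    have h := (Submodule.mem_orthogonal _ _).1 hf _ (Submodule.subset_span (mem_range_self n))
    simp only [inner_vecT_left, orthoT, mul_smul, integral_smul] at h
    exact (smul_eq_zero.1 h).resolve_left (normT_pos n).ne'
  exact Lp.eq_zero_iff_ae_eq_zero.2 ((weightMeasure_absolutelyContinuous ε).ae_le
    (ae_eq_zero_of_forall_polynomialSequence hε.ne' (integrableOn_coeFn hε f) _ h0))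

/-- The Hilbert basis of `X ε` formed by the functions `vecT hε n`. -/
def basisT (hε : 0 < ε) : HilbertBasis ℕ ℂ (X ε) :=
  HilbertBasis.mkOfOrthogonalEqBot (orthonormal_vecT hε) (orthogonal_span_vecT hε)

@[simp]
lemma coe_basisT (hε : 0 < ε) : ⇑(basisT hε) = vecT hε :=
  HilbertBasis.coe_mkOfOrthogonalEqBot _ _

end FirstKind

section SecondKind

variable {ε : ℝ}

/-- The function `√(1 - z²) U_n(z)`, normalized in `L²(dz / √(1 - z²))`. -/
def orthoU (n : ℕ) (z : ℝ) : ℝ := √(2 / Real.pi) * (√(1 - z ^ 2) * (U ℝ n).eval z)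

@[fun_prop]
lemma continuous_orthoU (n : ℕ) : Continuous (orthoU n) := by
  unfold orthoU
  fun_prop

lemma orthoU_cos (n : ℕ) {t : ℝ} (ht : t ∈ Icc 0 Real.pi) :
    orthoU n (Real.cos t) = √(2 / Real.pi) * Real.sin ((n + 1) * t) := by
  have hU := Polynomial.Chebyshev.U_real_cos t n
  push_cast at hU
  rw [orthoU, ← hU, ← Real.sin_sq, Real.sqrt_sq (Real.sin_nonneg_of_mem_Icc ht)]
  ring

lemma integral_orthoU_mul_orthoU (m n : ℕ) :
    ∫ z, orthoU m z * orthoU n z ∂measureT = if m = n then 1 else 0 := by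
  have hpi := Real.pi_pos
  have h : ∫ z, orthoU m z * orthoU n z ∂measureT
      = ∫ z, Real.pi⁻¹ * ((T ℝ ((m : ℤ) - n)).eval z - (T ℝ ((m : ℤ) + n + 2)).eval z)
        ∂measureT := by
    rw [Polynomial.Chebyshev.integral_measureT_eq_integral_cos,
      Polynomial.Chebyshev.integral_measureT_eq_integral_cos]
    refine intervalIntegral.integral_congr fun t ht => ?_
    rw [uIcc_of_le hpi.le] at ht
    have hsq : √(2 / Real.pi) * √(2 / Real.pi) = 2 / Real.pi :=
      Real.mul_self_sqrt (by positivity)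
    simp only [Polynomial.Chebyshev.T_real_cos, orthoU_cos _ ht]
    push_cast
    rw [show ((m : ℝ) - n) * t = (m + 1) * t - (n + 1) * t by ring,
      show ((m : ℝ) + n + 2) * t = (m + 1) * t + (n + 1) * t by ring,
      Real.cos_sub, Real.cos_add, mul_mul_mul_comm, hsq]
    ring
  rw [h, integral_const_mul, integral_sub
    (Polynomial.Chebyshev.integrable_measureT (by fun_prop))
    (Polynomial.Chebyshev.integrable_measureT (by fun_prop)),
    Polynomial.Chebyshev.integral_eval_T_real_measureT_of_ne_zero (n := (m : ℤ) + n + 2) (by omega)]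
  rcases eq_or_ne m n with rfl | hmn
  · rw [sub_self, Polynomial.Chebyshev.integral_eval_T_real_measureT_zero, sub_zero, if_pos rfl,
      inv_mul_cancel₀ hpi.ne']
  · rw [Polynomial.Chebyshev.integral_eval_T_real_measureT_of_ne_zero (by omega), if_neg hmn,
      sub_self, mul_zero]

/-- The orthonormal functions `U_n(y/ε)` of `X ε`, up to normalization. -/
def vecU (hε : 0 < ε) (n : ℕ) : X ε := chebyshevLift hε (continuous_orthoU n)

lemma inner_vecU_left (hε : 0 < ε) (n : ℕ) (f : X ε) :
    inner ℂ (vecU hε n) f = ∫ y in Icc (-ε) ε, orthoU n (y / ε) • f y :=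
  inner_chebyshevLift_left hε _ f

lemma coeFn_vecU (hε : 0 < ε) (n : ℕ) :
    ⇑(vecU hε n) =ᵐ[volume.restrict (Icc (-ε) ε)]
      fun y => ((√(2 / Real.pi) / ε * (U ℝ n).eval (y / ε) : ℝ) : ℂ) := by
  filter_upwards [coeFn_chebyshevLift hε (continuous_orthoU n), ae_weight_pos ε] with y hy hw
  rw [vecU, hy, orthoU]
  congr 1
  have hw' := weight_eq_mul hε y
  have hs : √(1 - (y / ε) ^ 2) ≠ 0 := fun hs => by simp [hw', hs] at hw
  rw [hw']
  generalize √(1 - (y / ε) ^ 2) = s at hs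
  field_simp

lemma orthonormal_vecU (hε : 0 < ε) : Orthonormal ℂ (vecU hε) :=
  orthonormal_chebyshevLift hε continuous_orthoU integral_orthoU_mul_orthoU

/-- The Chebyshev polynomials of the second kind as a polynomial sequence. -/
def chebyshevUSequence : Polynomial.Sequence ℝ where
  elems' n := U ℝ n
  degree_eq' n := Polynomial.Chebyshev.degree_U_natCast ℝ n

lemma orthogonal_span_vecU (hε : 0 < ε) : (Submodule.span ℂ (range (vecU hε)))ᗮ = ⊥ := by
  rw [Submodule.eq_bot_iff]
  intro f hf
  set h : ℝ → ℂ := fun y => √(1 - (y / ε) ^ 2) • f y with hh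
  have hint : IntegrableOn h (Icc (-ε) ε) :=
    (integrableOn_coeFn hε f).continuousOn_smul (by fun_prop) isCompact_Icc
  have h0 (n : ℕ) : ∫ y in Icc (-ε) ε, (chebyshevUSequence n).eval (y / ε) • h y = 0 := by
    have h := (Submodule.mem_orthogonal _ _).1 hf _ (Submodule.subset_span (mem_range_self n))
    simp only [inner_vecU_left, orthoU, mul_smul, integral_smul] at h
    simp only [hh, smul_comm _ √(1 - _)]
    exact (smul_eq_zero.1 h).resolve_left (by positivity)
  refine Lp.eq_zero_iff_ae_eq_zero.2 ((weightMeasure_absolutelyContinuous ε).ae_le ?_)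
  filter_upwards [ae_eq_zero_of_forall_polynomialSequence hε.ne' hint _ h0, ae_weight_pos ε]
    with y hy hw
  refine (smul_eq_zero.1 hy).resolve_left fun hs => hw.ne' ?_
  rw [weight_eq_mul hε, hs, mul_zero]

/-- The Hilbert basis of `X ε` formed by the functions `vecU hε n`. -/
def basisU (hε : 0 < ε) : HilbertBasis ℕ ℂ (X ε) :=
  HilbertBasis.mkOfOrthogonalEqBot (orthonormal_vecU hε) (orthogonal_span_vecU hε)

@[simp]
lemma coe_basisU (hε : 0 < ε) : ⇑(basisU hε) = vecU hε :=
  HilbertBasis.coe_mkOfOrthogonalEqBot _ _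

lemma hasDerivAt_orthoT_succ_div (hε : 0 < ε) (n : ℕ) (y : ℝ) :
    HasDerivAt (fun y => orthoT (n + 1) (y / ε) / (n + 1))
      (√(2 / Real.pi) / ε * (U ℝ n).eval (y / ε)) y := by
  have hT := ((T ℝ (n + 1 : ℕ)).hasDerivAt (y / ε)).comp y ((hasDerivAt_id y).div_const ε)
  rw [Polynomial.Chebyshev.T_derivative_eq_U] at hT
  convert! (hT.const_mul (normT (n + 1))).div_const (n + 1 : ℝ) using 1
  rw [normT_of_ne_zero n.succ_ne_zero]
  push_cast
  simp only [add_sub_cancel_right, Polynomial.eval_mul, Polynomial.eval_add,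
    Polynomial.eval_natCast, Polynomial.eval_one]
  field_simp

end SecondKind

section LogSeries

variable {z : ℂ}

lemma cauchySeq_sum_pow_div (hz : ‖z‖ ≤ 1) (hz1 : z ≠ 1) :
    CauchySeq fun N => ∑ n ∈ Finset.range N, z ^ n / (n : ℂ) := by
  have hshift : CauchySeq fun N => ∑ n ∈ Finset.range N, (1 / ((n : ℝ) + 1)) • z ^ (n + 1) := by
    refine Antitone.cauchySeq_series_mul_of_tendsto_zero_of_bounded (b := 2 / ‖z - 1‖)
      (fun m n hmn => one_div_le_one_div_of_le (by positivity) (by gcongr))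
      tendsto_one_div_add_atTop_nhds_zero_nat fun n => ?_
    have hpow : ‖z ^ n‖ ≤ 1 := by rw [norm_pow]; exact pow_le_one₀ (norm_nonneg z) hz
    simp_rw [pow_succ, ← Finset.sum_mul]
    rw [geom_sum_eq hz1, norm_mul, norm_div]
    calc ‖z ^ n - 1‖ / ‖z - 1‖ * ‖z‖ ≤ ‖z ^ n - 1‖ / ‖z - 1‖ * 1 := by gcongr
      _ ≤ 2 / ‖z - 1‖ := by
          rw [mul_one]
          gcongr
          linarith [norm_sub_le (z ^ n) 1, norm_one (α := ℂ)]
  rw [← cauchySeq_shift 1]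
  convert hshift using 2 with N
  rw [Finset.sum_range_succ']
  simp [div_eq_inv_mul]

lemma one_sub_mem_slitPlane (hz : ‖z‖ ≤ 1) (hz1 : z ≠ 1) : 1 - z ∈ Complex.slitPlane := by
  rw [Complex.mem_slitPlane_iff_not_le_zero, Complex.le_def]
  rintro ⟨hre, him⟩
  have hz_re : z.re ≤ 1 := (Complex.re_le_norm z).trans hz
  refine hz1 (Complex.ext ?_ ?_) <;> simp at hre him ⊢ <;> linarith

-- The radial limits of the power series are computed by continuity of the logarithm, and Abel's
-- theorem identifies them with the sum of the series on the unit circle.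
lemma tendsto_sum_pow_div_neg_log (hz : ‖z‖ ≤ 1) (hz1 : z ≠ 1) :
    Tendsto (fun N => ∑ n ∈ Finset.range N, z ^ n / (n : ℂ)) atTop
      (𝓝 (-Complex.log (1 - z))) := by
  obtain ⟨l, hl⟩ := cauchySeq_tendsto_of_complete (cauchySeq_sum_pow_div hz hz1)
  have hAbel := Complex.tendsto_tsum_powerSeries_nhdsWithin_lt hl
  rw [tendsto_map'_iff] at hAbel
  have hradial : Tendsto (fun r : ℝ => -Complex.log (1 - z * r)) (𝓝[<] 1)
      (𝓝 (-Complex.log (1 - z))) := by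
    have hc : ContinuousAt (fun r : ℝ => -Complex.log (1 - z * r)) 1 :=
      (ContinuousAt.clog (by fun_prop) (by simpa using one_sub_mem_slitPlane hz hz1)).neg
    simpa using hc.tendsto.mono_left nhdsWithin_le_nhds
  have heq : (fun r : ℝ => -Complex.log (1 - z * r)) =ᶠ[𝓝[<] 1]
      ((fun w => ∑' n : ℕ, z ^ n / (n : ℂ) * w ^ n) ∘ Complex.ofReal) := by
    filter_upwards [Ioo_mem_nhdsLT (zero_lt_one (α := ℝ))] with r hr
    have hzr : ‖z * r‖ < 1 := by
      rw [norm_mul, Complex.norm_real, Real.norm_of_nonneg hr.1.le]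
      nlinarith [hr.1, hr.2]
    rw [← (Complex.hasSum_taylorSeries_neg_log hzr).tsum_eq]
    exact tsum_congr fun n => by rw [mul_pow]; ring
  rwa [tendsto_nhds_unique (hradial.congr' heq) hAbel]

lemma tendsto_sum_cos_div {φ : ℝ} (hφ : Complex.exp (φ * Complex.I) ≠ 1) :
    Tendsto (fun N => ∑ n ∈ Finset.range N, Real.cos (n * φ) / (n : ℝ)) atTop
      (𝓝 (-Real.log ‖1 - Complex.exp (φ * Complex.I)‖)) := by
  have h := (Complex.continuous_re.tendsto _).comp
    (tendsto_sum_pow_div_neg_log (Complex.norm_exp_ofReal_mul_I φ).le hφ)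
  rw [Complex.neg_re, Complex.log_re] at h
  refine h.congr fun N => ?_
  simp only [Function.comp_apply, Complex.re_sum]
  refine Finset.sum_congr rfl fun n _ => ?_
  rw [← Complex.exp_nat_mul, ← mul_assoc, ← Complex.ofReal_natCast, ← Complex.ofReal_mul,
    Complex.div_ofReal_re, Complex.exp_ofReal_mul_I_re]

lemma one_sub_exp_mul_one_sub_exp (s t : ℝ) :
    (1 - Complex.exp ((s + t : ℝ) * Complex.I)) * (1 - Complex.exp ((s - t : ℝ) * Complex.I))
      = Complex.exp (s * Complex.I) * ((2 * (Real.cos s - Real.cos t) : ℝ) : ℂ) := by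
  have hs := Complex.exp_ne_zero (s * Complex.I)
  have := Complex.exp_ne_zero (t * Complex.I)
  push_cast
  simp only [mul_sub, Complex.two_cos, add_mul, sub_mul, neg_mul, Complex.exp_add,
    Complex.exp_sub, Complex.exp_neg]
  field_simp
  ring

lemma tendsto_sum_cos_mul_cos {s t : ℝ} (hst : Real.cos s ≠ Real.cos t) :
    Tendsto (fun N => ∑ n ∈ Finset.range N, -(2 * Real.cos (n * s) * Real.cos (n * t) / n)) atTop
      (𝓝 (Real.log |2 * (Real.cos s - Real.cos t)|)) := by
  have hprod := one_sub_exp_mul_one_sub_exp s t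
  have hne : (1 - Complex.exp ((s + t : ℝ) * Complex.I))
      * (1 - Complex.exp ((s - t : ℝ) * Complex.I)) ≠ 0 := by
    rw [hprod]
    exact mul_ne_zero (Complex.exp_ne_zero _)
      (by exact_mod_cast mul_ne_zero two_ne_zero (sub_ne_zero.2 hst))
  have hadd := left_ne_zero_of_mul hne
  have hsub := right_ne_zero_of_mul hne
  have hlim := ((tendsto_sum_cos_div (sub_ne_zero.1 hadd).symm).add
    (tendsto_sum_cos_div (sub_ne_zero.1 hsub).symm)).neg
  have hval : -(-Real.log ‖1 - Complex.exp ((s + t : ℝ) * Complex.I)‖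
      + -Real.log ‖1 - Complex.exp ((s - t : ℝ) * Complex.I)‖)
      = Real.log |2 * (Real.cos s - Real.cos t)| := by
    rw [neg_add, neg_neg, neg_neg, ← Real.log_mul (norm_ne_zero_iff.2 hadd)
      (norm_ne_zero_iff.2 hsub), ← norm_mul, hprod, norm_mul, Complex.norm_exp_ofReal_mul_I,
      one_mul, Complex.norm_real, Real.norm_eq_abs]
  rw [hval] at hlim
  refine hlim.congr fun N => ?_
  rw [← Finset.sum_add_distrib, ← Finset.sum_neg_distrib]
  refine Finset.sum_congr rfl fun n _ => ?_
  rw [mul_add, mul_sub, Real.cos_add, Real.cos_sub]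
  ring

lemma tendsto_sum_chebyshevT_mul_chebyshevT {x y : ℝ} (hx : |x| ≤ 1) (hy : |y| ≤ 1)
    (hxy : x ≠ y) :
    Tendsto (fun N => ∑ n ∈ Finset.range N, -(2 * (T ℝ n).eval x * (T ℝ n).eval y / n)) atTop
      (𝓝 (Real.log |2 * (x - y)|)) := by
  obtain ⟨hx₁, hx₂⟩ := abs_le.1 hx
  obtain ⟨hy₁, hy₂⟩ := abs_le.1 hy
  rw [← Real.cos_arccos hx₁ hx₂, ← Real.cos_arccos hy₁ hy₂] at hxy ⊢
  simpa only [Polynomial.Chebyshev.T_real_cos, Int.cast_natCast] using tendsto_sum_cos_mul_cos hxy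

end LogSeries

section LogKernel

variable {ε : ℝ}

lemma abs_coe_div_le_one (x : Icc (-ε) ε) : |(x : ℝ) / ε| ≤ 1 := by
  have hε : 0 ≤ ε := by linarith [x.2.1, x.2.2]
  rw [abs_div, abs_of_nonneg hε]
  exact div_le_one_of_le₀ (abs_le.2 x.2) hε

/-- The coefficients of `log |2 (z - y)|` in the orthonormal system `orthoT`. The division by zero
makes the one of index `0` vanish, as it should. -/
def logCoeff (z : ℝ) (n : ℕ) : ℝ := -(Real.pi / n * orthoT n z)

@[simp]
lemma logCoeff_zero (z : ℝ) : logCoeff z 0 = 0 := by simp [logCoeff]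

lemma abs_logCoeff_le {z : ℝ} (hz : |z| ≤ 1) (n : ℕ) : |logCoeff z n| ≤ Real.pi / n := by
  have := Real.pi_pos
  rw [logCoeff, abs_neg, abs_mul, abs_of_nonneg (by positivity)]
  exact mul_le_of_le_one_right (by positivity) (abs_orthoT_le_one n hz)

lemma logCoeff_mul_orthoT (x y : ℝ) (n : ℕ) :
    logCoeff x n * orthoT n y = -(2 * (T ℝ n).eval x * (T ℝ n).eval y / n) := by
  rcases eq_or_ne n 0 with rfl | hn
  · simp
  · have hsq : normT n * normT n * Real.pi = 2 := by
      rw [normT_of_ne_zero hn, Real.mul_self_sqrt (by positivity)]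
      field_simp
    rw [logCoeff, orthoT, orthoT]
    linear_combination -((T ℝ n).eval x * (T ℝ n).eval y / n) * hsq

lemma summable_pi_div_sq : Summable fun n : ℕ => (Real.pi / (n : ℝ)) ^ 2 := by
  simp_rw [div_eq_mul_one_div Real.pi, mul_pow, one_div_pow]
  exact hasSum_zeta_two.summable.mul_left (Real.pi ^ 2)

lemma memℓp_logCoeff {z : ℝ} (hz : |z| ≤ 1) : Memℓp (fun n => (logCoeff z n : ℂ)) 2 := by
  refine memℓp_gen ?_
  simp only [ENNReal.toReal_ofNat, Real.rpow_ofNat, Complex.norm_real, Real.norm_eq_abs]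
  refine Summable.of_nonneg_of_le (fun n => by positivity) (fun n => ?_) summable_pi_div_sq
  gcongr
  exact abs_logCoeff_le hz n

/-- The component of the logarithmic kernel `log |x - ·| / √(ε² - y²)` orthogonal to
`vecT hε 0`. -/
def logRemainder (hε : 0 < ε) (x : Icc (-ε) ε) : X ε :=
  (basisT hε).repr.symm ⟨_, memℓp_logCoeff (abs_coe_div_le_one x)⟩

lemma repr_logRemainder (hε : 0 < ε) (x : Icc (-ε) ε) (n : ℕ) :
    (basisT hε).repr (logRemainder hε x) n = logCoeff (x / ε) n := by
  rw [logRemainder, LinearIsometryEquiv.apply_symm_apply]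

lemma norm_logRemainder_le (hε : 0 < ε) (x : Icc (-ε) ε) : ‖logRemainder hε x‖ ≤ Real.pi ^ 2 := by
  have := Real.pi_pos
  refine le_of_sq_le_sq ?_ (by positivity)
  have hnorm := lp.norm_rpow_eq_tsum (by norm_num) ((basisT hε).repr (logRemainder hε x))
  simp only [ENNReal.toReal_ofNat, Real.rpow_ofNat, LinearIsometryEquiv.norm_map,
    repr_logRemainder, Complex.norm_real, Real.norm_eq_abs] at hnorm
  calc ‖logRemainder hε x‖ ^ 2 = ∑' n, |logCoeff (x / ε) n| ^ 2 := hnorm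
    _ ≤ ∑' n : ℕ, (Real.pi / n) ^ 2 := by
        have hle (n : ℕ) : |logCoeff (x / ε) n| ^ 2 ≤ (Real.pi / n) ^ 2 := by
          gcongr
          exact abs_logCoeff_le (abs_coe_div_le_one x) n
        exact (Summable.of_nonneg_of_le (fun n => by positivity) hle
          summable_pi_div_sq).tsum_le_tsum hle summable_pi_div_sq
    _ = Real.pi ^ 2 * (Real.pi ^ 2 / 6) := by
        rw [← hasSum_zeta_two.tsum_eq, ← tsum_mul_left]
        exact tsum_congr fun n => by ring
    _ ≤ (Real.pi ^ 2) ^ 2 := by nlinarith [sq_nonneg (Real.pi ^ 2)]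

lemma inner_vecT_zero_logRemainder (hε : 0 < ε) (x : Icc (-ε) ε) :
    inner ℂ (vecT hε 0) (logRemainder hε x) = 0 := by
  rw [← coe_basisT, ← HilbertBasis.repr_apply_apply, repr_logRemainder, logCoeff_zero,
    Complex.ofReal_zero]

lemma hasSum_logRemainder (hε : 0 < ε) (x : Icc (-ε) ε) :
    HasSum (fun n => (logCoeff (x / ε) n : ℂ) • vecT hε n) (logRemainder hε x) := by
  simpa only [coe_basisT, repr_logRemainder] using (basisT hε).hasSum_repr (logRemainder hε x)

lemma coeFn_sum_smul_vecT (hε : 0 < ε) (c : ℕ → ℝ) (N : ℕ) :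
    ⇑(∑ n ∈ Finset.range N, (c n : ℂ) • vecT hε n) =ᵐ[volume.restrict (Icc (-ε) ε)]
      fun y => (((∑ n ∈ Finset.range N, c n * orthoT n (y / ε)) / weight ε y : ℝ) : ℂ) := by
  have hsmul : ∀ᵐ y ∂volume.restrict (Icc (-ε) ε), ∀ n,
      ((c n : ℂ) • vecT hε n : X ε) y = c n * vecT hε n y :=
    ae_all_iff.2 fun n => (absolutelyContinuous_weightMeasure ε).ae_le (Lp.coeFn_smul _ _)
  have hvec : ∀ᵐ y ∂volume.restrict (Icc (-ε) ε), ∀ n,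
      vecT hε n y = ((orthoT n (y / ε) / weight ε y : ℝ) : ℂ) :=
    ae_all_iff.2 fun n => coeFn_chebyshevLift hε (continuous_orthoT n)
  have hsum := (absolutelyContinuous_weightMeasure ε).ae_le
    (Lp.coeFn_finsetSum (Finset.range N) fun n => ((c n : ℂ) • vecT hε n : X ε))
  filter_upwards [hsum, hsmul, hvec] with y h₁ h₂ h₃
  rw [h₁, Finset.sum_apply, Finset.sum_div, Complex.ofReal_sum]
  refine Finset.sum_congr rfl fun n _ => ?_
  rw [h₂, h₃, ← Complex.ofReal_mul, mul_div_assoc]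

lemma coeFn_logRemainder (hε : 0 < ε) (x : Icc (-ε) ε) :
    ⇑(logRemainder hε x) =ᵐ[volume.restrict (Icc (-ε) ε)]
      fun y => ((Real.log |2 * (x / ε - y / ε)| : ℝ) : ℂ) / weight ε y := by
  obtain ⟨ns, hns, hae⟩ := (tendstoInMeasure_of_tendsto_Lp
    (hasSum_logRemainder hε x).tendsto_sum_nat).exists_seq_tendsto_ae
  have hne : ∀ᵐ y ∂volume.restrict (Icc (-ε) ε), y ≠ (x : ℝ) :=
    ae_restrict_of_ae (Measure.ae_ne volume (x : ℝ))
  filter_upwards [(absolutelyContinuous_weightMeasure ε).ae_le hae,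
    ae_all_iff.2 (coeFn_sum_smul_vecT hε (logCoeff (x / ε))), hne,
    ae_restrict_mem measurableSet_Icc] with y hlim hsum hyx hy
  have hxy : (x : ℝ) / ε ≠ y / ε := fun h => hyx ((div_left_inj' hε.ne').1 h).symm
  have hseries := ((tendsto_sum_chebyshevT_mul_chebyshevT (abs_coe_div_le_one x)
    (abs_coe_div_le_one ⟨y, hy⟩) hxy).comp hns.tendsto_atTop).div_const (weight ε y)
  rw [← Complex.ofReal_div]
  refine tendsto_nhds_unique hlim (((Complex.continuous_ofReal.tendsto _).comp hseries).congr
    fun i => ?_)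
  simp only [Function.comp_apply, hsum, logCoeff_mul_orthoT]

end LogKernel

section ShiftIsometry

variable {ε : ℝ}

/-- The isometry of `X ε` taking `vecU hε n` to `vecT hε (n + 1)`. Up to the factor `-π`, its
adjoint is `f ↦ (L ε f)'`. -/
def shiftIsometry (hε : 0 < ε) : X ε →ₗᵢ[ℂ] X ε :=
  ((orthonormal_vecT hε).comp _ Nat.succ_injective).orthogonalFamily.linearIsometry.comp
    (basisU hε).repr.toLinearIsometry

lemma shiftIsometry_vecU (hε : 0 < ε) (n : ℕ) :
    shiftIsometry hε (vecU hε n) = vecT hε (n + 1) := by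
  rw [shiftIsometry, LinearIsometry.coe_comp, Function.comp_apply,
    LinearIsometryEquiv.coe_toLinearIsometry, ← coe_basisU, HilbertBasis.repr_self,
    OrthogonalFamily.linearIsometry_apply_single,
    LinearIsometry.toSpanSingleton_apply, one_smul, Function.comp_apply]

lemma dense_span_vecU (hε : 0 < ε) :
    Dense (Submodule.span ℂ (range (vecU hε)) : Set (X ε)) := by
  rw [← coe_basisU, Submodule.dense_iff_topologicalClosure_eq_top]
  exact (basisU hε).dense_span

lemma inner_vecT_zero_shiftIsometry (hε : 0 < ε) (g : X ε) :
    inner ℂ (vecT hε 0) (shiftIsometry hε g) = 0 := by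
  have h : innerSL ℂ (vecT hε 0) ∘L (shiftIsometry hε).toContinuousLinearMap = 0 := by
    refine ContinuousLinearMap.ext_on (dense_span_vecU hε) ?_
    rintro _ ⟨n, rfl⟩
    simpa [shiftIsometry_vecU] using (orthonormal_vecT hε).inner_eq_zero n.succ_ne_zero.symm
  exact DFunLike.congr_fun h g

lemma eq_of_forall_inner_vecT_eq (hε : 0 < ε) {f g : X ε}
    (h : ∀ n, inner ℂ (vecT hε n) f = inner ℂ (vecT hε n) g) : f = g := by
  refine (basisT hε).repr.injective (lp.ext (funext fun n => ?_))
  rw [HilbertBasis.repr_apply_apply, HilbertBasis.repr_apply_apply, coe_basisT, h]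

lemma exists_eq_smul_add_shiftIsometry (hε : 0 < ε) (f : X ε) :
    ∃ (β : ℂ) (h : X ε), f = β • vecT hε 0 + shiftIsometry hε h := by
  set V := (shiftIsometry hε).toContinuousLinearMap
  refine ⟨inner ℂ (vecT hε 0) f, ContinuousLinearMap.adjoint V f,
    eq_of_forall_inner_vecT_eq hε fun n => ?_⟩
  rw [inner_add_right, inner_smul_right]
  cases n with
  | zero =>
    rw [inner_vecT_zero_shiftIsometry, add_zero, inner_self_eq_norm_sq_to_K,
      (orthonormal_vecT hε).norm_eq_one]
    simp
  | succ n =>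
    rw [(orthonormal_vecT hε).inner_eq_zero n.succ_ne_zero, mul_zero, zero_add,
      ← shiftIsometry_vecU, LinearIsometry.inner_map_map,
      ContinuousLinearMap.adjoint_inner_right]
    rfl

end ShiftIsometry

section Primitive

variable {ε : ℝ}

lemma memLp_indicator_div_weight (hε : 0 < ε) (x y : ℝ) :
    MemLp (fun t => (Ioc x y).indicator 1 t / weight ε t : ℝ → ℂ) 2 (weightMeasure ε) :=
  memLp_div_weight (C := 1) hε
    (stronglyMeasurable_one.indicator measurableSet_Ioc).aestronglyMeasurable fun t _ =>
      (norm_indicator_le_norm_self _ _).trans (by simp)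

lemma inner_divWeight_indicator (hε : 0 < ε) {x y : Icc (-ε) ε} (hxy : x ≤ y) (g : X ε) :
    inner ℂ (divWeight _ (memLp_indicator_div_weight hε x y)) g
      = ∫ t in (x : ℝ)..(y : ℝ), g t := by
  have h (t : ℝ) : conj ((Ioc (x : ℝ) y).indicator (1 : ℝ → ℂ) t) * g t
      = (Ioc (x : ℝ) y).indicator g t := by
    by_cases ht : t ∈ Ioc (x : ℝ) y <;> simp [ht]
  simp_rw [inner_divWeight_left, h]
  rw [setIntegral_indicator measurableSet_Ioc, inter_eq_right.2
    (Ioc_subset_Icc_self.trans (Icc_subset_Icc x.2.1 y.2.2)), intervalIntegral.integral_of_le hxy]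

lemma integral_congr_of_ae_restrict_Icc {f g : ℝ → ℂ}
    (h : f =ᵐ[volume.restrict (Icc (-ε) ε)] g) (x y : Icc (-ε) ε) :
    ∫ t in (x : ℝ)..(y : ℝ), f t = ∫ t in (x : ℝ)..(y : ℝ), g t := by
  have hsub : uIoc (x : ℝ) y ⊆ Icc (-ε) ε :=
    uIoc_subset_uIcc.trans ((convex_Icc (-ε) ε).ordConnected.uIcc_subset x.2 y.2)
  exact intervalIntegral.integral_congr_ae
    (((ae_restrict_iff' measurableSet_Icc).1 h).mono fun t ht hmem => ht (hsub hmem))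

lemma integral_coeFn_smul (c : ℂ) (g : X ε) (x y : Icc (-ε) ε) :
    ∫ t in (x : ℝ)..(y : ℝ), (c • g) t = c * ∫ t in (x : ℝ)..(y : ℝ), g t := by
  rw [← intervalIntegral.integral_const_mul]
  exact integral_congr_of_ae_restrict_Icc
    ((absolutelyContinuous_weightMeasure ε).ae_le (Lp.coeFn_smul c g)) x y

lemma integral_vecU (hε : 0 < ε) (n : ℕ) (x y : Icc (-ε) ε) :
    ∫ t in (x : ℝ)..(y : ℝ), vecU hε n t
      = ((orthoT (n + 1) (y / ε) / (n + 1) - orthoT (n + 1) (x / ε) / (n + 1) : ℝ) : ℂ) := by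
  rw [integral_congr_of_ae_restrict_Icc (coeFn_vecU hε n), intervalIntegral.integral_ofReal,
    intervalIntegral.integral_eq_sub_of_hasDerivAt fun t _ => hasDerivAt_orthoT_succ_div hε n t]
  exact Continuous.intervalIntegrable (by fun_prop) _ _

lemma intervalIntegrable_coeFn (hε : 0 < ε) (g : X ε) (x y : Icc (-ε) ε) :
    IntervalIntegrable g volume x y :=
  ((integrableOn_coeFn hε g).mono_set
    ((convex_Icc (-ε) ε).ordConnected.uIcc_subset x.2 y.2)).intervalIntegrable

lemma eq_zero_of_forall_integral_eq_zero (hε : 0 < ε) {g : X ε}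
    (hg : ∀ x y : Icc (-ε) ε, ∫ t in (x : ℝ)..(y : ℝ), g t = 0) : g = 0 := by
  have hle : -ε ≤ ε := by linarith
  have hderiv := (intervalIntegrable_coeFn hε g ⟨-ε, left_mem_Icc.2 hle⟩
    ⟨ε, right_mem_Icc.2 hle⟩).ae_hasDerivAt_integral
  rw [uIcc_of_le hle] at hderiv
  refine Lp.eq_zero_iff_ae_eq_zero.2 ((weightMeasure_absolutelyContinuous ε).ae_le ?_)
  rw [← restrict_Ioo_eq_restrict_Icc]
  filter_upwards [ae_restrict_of_ae hderiv, ae_restrict_mem measurableSet_Ioo] with y hy hmem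
  have hconst : (fun x => ∫ t in (-ε)..x, g t) =ᶠ[𝓝 y] fun _ => 0 := by
    filter_upwards [Icc_mem_nhds hmem.1 hmem.2] with x hx
    exact hg ⟨-ε, left_mem_Icc.2 hle⟩ ⟨x, hx⟩
  exact (hy (Ioo_subset_Icc_self hmem) (-ε) (left_mem_Icc.2 hle)).unique
    ((hasDerivAt_const y (0 : ℂ)).congr_of_eventuallyEq hconst)

lemma continuous_of_sub_eq_integral (hε : 0 < ε) {ψ : Icc (-ε) ε → ℂ} {g : X ε}
    (h : ∀ x y : Icc (-ε) ε, ψ y - ψ x = ∫ t in (x : ℝ)..(y : ℝ), g t) : Continuous ψ := by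
  have hle : -ε ≤ ε := by linarith
  have hc := intervalIntegral.continuousOn_primitive_interval (f := g) (a := -ε) (b := ε)
    (μ := volume) (by rw [uIcc_of_le hle]; exact integrableOn_coeFn hε g)
  rw [uIcc_of_le hle] at hc
  have hψ (y : Icc (-ε) ε) : ψ ⟨-ε, left_mem_Icc.2 hle⟩ + ∫ t in (-ε)..(y : ℝ), g t = ψ y :=
    add_eq_of_eq_sub' (h ⟨-ε, left_mem_Icc.2 hle⟩ y).symm
  exact (continuous_const.add (continuousOn_iff_continuous_domRestrict.1 hc)).congr hψ

end Primitive

section LogOperator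

variable {ε : ℝ}

/-- The constant value of `L ε (vecT hε 0)`. -/
def logConst (ε : ℝ) : ℝ := √Real.pi * Real.log (ε / 2)

lemma logConst_neg (hε : 0 < ε) (hε2 : ε < 2) : logConst ε < 0 :=
  mul_neg_of_pos_of_neg (by have := Real.pi_pos; positivity)
    (Real.log_neg (by positivity) (by linarith))

/-- The Riesz representative of the functional `f ↦ L ε f x`. -/
def logKernel (hε : 0 < ε) (x : Icc (-ε) ε) : X ε :=
  (logConst ε : ℂ) • vecT hε 0 + logRemainder hε x

lemma coeFn_logKernel (hε : 0 < ε) (x : Icc (-ε) ε) :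
    ⇑(logKernel hε x) =ᵐ[volume.restrict (Icc (-ε) ε)]
      fun y => ((Real.log |(x : ℝ) - y| : ℝ) : ℂ) / weight ε y := by
  have hac := (absolutelyContinuous_weightMeasure ε).ae_le
  have hne : ∀ᵐ y ∂volume.restrict (Icc (-ε) ε), y ≠ (x : ℝ) :=
    ae_restrict_of_ae (Measure.ae_ne volume (x : ℝ))
  filter_upwards [hac (Lp.coeFn_add ((logConst ε : ℂ) • vecT hε 0) (logRemainder hε x)),
    hac (Lp.coeFn_smul (logConst ε : ℂ) (vecT hε 0)),
    coeFn_chebyshevLift hε (continuous_orthoT 0), coeFn_logRemainder hε x, hne]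
    with y hadd hsmul hT hrem hyx
  have hlog : Real.log |(x : ℝ) - y| = Real.log (ε / 2) + Real.log |2 * (x / ε - y / ε)| := by
    rw [Real.log_abs, Real.log_abs, ← sub_div, ← Real.log_mul (by positivity)
      (mul_ne_zero two_ne_zero (div_ne_zero (sub_ne_zero.2 hyx.symm) hε.ne'))]
    congr 1
    field_simp
  have hconst : logConst ε * orthoT 0 (y / ε) = Real.log (ε / 2) := by
    have := Real.pi_pos
    rw [logConst, orthoT_zero]
    field_simp
  rw [logKernel, hadd, Pi.add_apply, hsmul, Pi.smul_apply, smul_eq_mul, hrem, vecT, hT,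
    ← Complex.ofReal_mul, ← mul_div_assoc, hconst, hlog]
  push_cast
  ring

lemma L_apply_eq_inner (hε : 0 < ε) (f : X ε) (x : Icc (-ε) ε) :
    L ε f x = inner ℂ (logKernel hε x) f := by
  rw [inner_eq_setIntegral_of_ae_eq_div_weight (coeFn_logKernel hε x), L,
    intervalIntegral.integral_of_le (by linarith), integral_Icc_eq_integral_Ioc]
  simp only [Complex.conj_ofReal]

lemma L_add (hε : 0 < ε) (f g : X ε) : L ε (f + g) = L ε f + L ε g := by
  ext x
  simp only [L_apply_eq_inner hε, inner_add_right, Pi.add_apply]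

lemma L_smul (hε : 0 < ε) (c : ℂ) (f : X ε) : L ε (c • f) = c • L ε f := by
  ext x
  simp only [L_apply_eq_inner hε, inner_smul_right, Pi.smul_apply, smul_eq_mul]

lemma L_vecT_zero (hε : 0 < ε) (x : Icc (-ε) ε) : L ε (vecT hε 0) x = logConst ε := by
  rw [L_apply_eq_inner hε, logKernel, inner_add_left, inner_smul_left, Complex.conj_ofReal,
    inner_eq_zero_symm.1 (inner_vecT_zero_logRemainder hε x), inner_self_eq_norm_sq_to_K,
    (orthonormal_vecT hε).norm_eq_one]
  simp

lemma L_shiftIsometry (hε : 0 < ε) (g : X ε) (x : Icc (-ε) ε) :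
    L ε (shiftIsometry hε g) x = inner ℂ (logRemainder hε x) (shiftIsometry hε g) := by
  rw [L_apply_eq_inner hε, logKernel, inner_add_left, inner_smul_left,
    inner_vecT_zero_shiftIsometry, mul_zero, zero_add]

lemma norm_L_shiftIsometry_le (hε : 0 < ε) (g : X ε) (x : Icc (-ε) ε) :
    ‖L ε (shiftIsometry hε g) x‖ ≤ Real.pi ^ 2 * ‖g‖ := by
  rw [L_shiftIsometry]
  refine (norm_inner_le_norm _ _).trans ?_
  rw [LinearIsometry.norm_map]
  gcongr
  exact norm_logRemainder_le hε x

lemma inner_logRemainder_vecT (hε : 0 < ε) (x : Icc (-ε) ε) (n : ℕ) :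
    inner ℂ (logRemainder hε x) (vecT hε n) = logCoeff (x / ε) n := by
  rw [← inner_conj_symm, ← coe_basisT, ← HilbertBasis.repr_apply_apply, repr_logRemainder,
    Complex.conj_ofReal]

lemma L_shiftIsometry_sub (hε : 0 < ε) (g : X ε) (x y : Icc (-ε) ε) :
    L ε (shiftIsometry hε g) y - L ε (shiftIsometry hε g) x
      = -Real.pi * ∫ t in (x : ℝ)..(y : ℝ), g t := by
  wlog hxy : x ≤ y
  · rw [intervalIntegral.integral_symm, mul_neg, ← this hε g y x (le_of_not_ge hxy), neg_sub]
  have h : innerSL ℂ (logRemainder hε y - logRemainder hε x) ∘L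
        (shiftIsometry hε).toContinuousLinearMap
      = (-Real.pi : ℂ) • innerSL ℂ (divWeight _ (memLp_indicator_div_weight hε x y)) := by
    refine ContinuousLinearMap.ext_on (dense_span_vecU hε) ?_
    rintro _ ⟨n, rfl⟩
    simp only [ContinuousLinearMap.comp_apply, LinearIsometry.coe_toContinuousLinearMap,
      innerSL_apply_apply, _root_.smul_apply, shiftIsometry_vecU, inner_sub_left,
      inner_logRemainder_vecT, inner_divWeight_indicator hε hxy, integral_vecU, smul_eq_mul,
      logCoeff]
    push_cast
    ring
  rw [L_shiftIsometry, L_shiftIsometry, ← inner_sub_left, ← inner_divWeight_indicator hε hxy]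
  exact DFunLike.congr_fun h g

lemma L_smul_add_shiftIsometry (hε : 0 < ε) (β : ℂ) (h : X ε) (x : Icc (-ε) ε) :
    L ε (β • vecT hε 0 + shiftIsometry hε h) x
      = β * logConst ε + L ε (shiftIsometry hε h) x := by
  simp only [L_add hε, L_smul hε, Pi.add_apply, Pi.smul_apply, L_vecT_zero, smul_eq_mul]

lemma L_mem_Y (hε : 0 < ε) (f : X ε) : L ε f ∈ Y ε := by
  obtain ⟨β, h, rfl⟩ := exists_eq_smul_add_shiftIsometry hε f
  have hsub (x y : Icc (-ε) ε) :
      L ε (β • vecT hε 0 + shiftIsometry hε h) y - L ε (β • vecT hε 0 + shiftIsometry hε h) x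
        = ∫ t in (x : ℝ)..(y : ℝ), ((-Real.pi : ℂ) • h : X ε) t := by
    rw [L_smul_add_shiftIsometry, L_smul_add_shiftIsometry, add_sub_add_left_eq_sub,
      L_shiftIsometry_sub, integral_coeFn_smul]
  exact ⟨continuous_of_sub_eq_integral hε hsub, _, hsub⟩

lemma L_injective (hε : 0 < ε) (hε2 : ε < 2) : Function.Injective (L ε) := by
  have hker (f : X ε) (hf : L ε f = 0) : f = 0 := by
    obtain ⟨β, h, rfl⟩ := exists_eq_smul_add_shiftIsometry hε f
    have hf' (x : Icc (-ε) ε) : β * logConst ε + L ε (shiftIsometry hε h) x = 0 :=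
      (L_smul_add_shiftIsometry hε β h x).symm.trans (congrFun hf x)
    obtain rfl : h = 0 := eq_zero_of_forall_integral_eq_zero hε fun x y => by
      have hint := L_shiftIsometry_sub hε h x y
      rw [← add_sub_add_left_eq_sub _ _ (β * logConst ε), hf', hf', sub_self] at hint
      exact (mul_eq_zero.1 hint.symm).resolve_left (by simp [Real.pi_ne_zero])
    have hβ := hf' ⟨0, by linarith, hε.le⟩
    rw [L_shiftIsometry, map_zero, inner_zero_right, add_zero] at hβ
    have hk : (logConst ε : ℂ) ≠ 0 := by exact_mod_cast (logConst_neg hε hε2).ne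
    rw [(mul_eq_zero.1 hβ).resolve_right hk, zero_smul, map_zero, add_zero]
  intro f g hfg
  refine sub_eq_zero.1 (hker _ ?_)
  rw [sub_eq_add_neg, ← neg_one_smul ℂ g, L_add hε, L_smul hε, hfg]
  simp

/-- The formula inverting `L ε`, for a function with derivative `g` and value `a` at `x₀`. -/
def logInverse (hε : 0 < ε) (x₀ : Icc (-ε) ε) (a : ℂ) (g : X ε) : X ε :=
  ((a + (Real.pi : ℂ)⁻¹ * L ε (shiftIsometry hε g) x₀) / logConst ε) • vecT hε 0
    + (-(Real.pi : ℂ)⁻¹) • shiftIsometry hε g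

lemma L_logInverse (hε : 0 < ε) (hε2 : ε < 2) {ψ : Icc (-ε) ε → ℂ} {g : X ε}
    (hψ : ∀ x y : Icc (-ε) ε, ψ y - ψ x = ∫ t in (x : ℝ)..(y : ℝ), g t) (x₀ : Icc (-ε) ε) :
    L ε (logInverse hε x₀ (ψ x₀) g) = ψ := by
  ext y
  have hk : (logConst ε : ℂ) ≠ 0 := by exact_mod_cast (logConst_neg hε hε2).ne
  have hpi : (Real.pi : ℂ) ≠ 0 := by exact_mod_cast Real.pi_ne_zero
  have hsub := L_shiftIsometry_sub hε g x₀ y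
  rw [← hψ] at hsub
  rw [logInverse, ← map_smul, L_smul_add_shiftIsometry, map_smul, L_smul hε, Pi.smul_apply,
    smul_eq_mul]
  field_simp
  linear_combination -hsub

theorem bijOn_L (hε : 0 < ε) (hε2 : ε < 2) : BijOn (L ε) univ (Y ε) := by
  refine ⟨fun f _ => L_mem_Y hε f, (L_injective hε hε2).injOn, ?_⟩
  rintro ψ ⟨-, g, hg⟩
  exact ⟨_, mem_univ _, L_logInverse hε hε2 hg ⟨0, by linarith, hε.le⟩⟩

lemma Linv_eq_logInverse (hε : 0 < ε) (hε2 : ε < 2) {ψ : Icc (-ε) ε → ℂ} {g : X ε}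
    (hψ : ∀ x y : Icc (-ε) ε, ψ y - ψ x = ∫ t in (x : ℝ)..(y : ℝ), g t) (x₀ : Icc (-ε) ε) :
    Linv ε ψ = logInverse hε x₀ (ψ x₀) g := by
  have hL := L_logInverse hε hε2 hψ x₀
  rw [Linv, ← hL, (L_injective hε hε2).injOn.leftInvOn_invFunOn (mem_univ _), hL]

end LogOperator

section LipschitzPrimitive

variable {ε : ℝ} {K : ℝ≥0} {ψ : ℝ → ℂ}

lemma norm_le_of_ae_norm_le (hε : 0 ≤ ε) {M : ℝ} (hM : 0 ≤ M) {g : X ε}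
    (hg : ∀ᵐ t ∂weightMeasure ε, ‖g t‖ ≤ M) : ‖g‖ ≤ 2 * ε * M := by
  refine (Lp.norm_le_of_ae_bound hM hg).trans ?_
  gcongr
  change (weightMeasure ε).real univ ^ _ ≤ _
  rw [ENNReal.toReal_ofNat, ← one_div, ← Real.sqrt_eq_rpow, Real.sqrt_le_left (by positivity)]
  nlinarith [weightMeasure_real_univ_le hε]

lemma intervalIntegrable_ofReal_deriv {f : ℝ → ℝ} {a b : ℝ}
    (hf : AbsolutelyContinuousOnInterval f a b) :
    IntervalIntegrable (fun t => ((deriv f t : ℝ) : ℂ)) volume a b :=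
  ⟨hf.intervalIntegrable_deriv.1.ofReal, hf.intervalIntegrable_deriv.2.ofReal⟩

lemma exists_sub_eq_integral_of_lipschitzOnWith (hε : 0 < ε)
    (hψ : LipschitzOnWith K ψ (Icc (-ε) ε)) :
    ∃ g : X ε, (∀ x y : Icc (-ε) ε, ψ y - ψ x = ∫ t in (x : ℝ)..(y : ℝ), g t) ∧
      ‖g‖ ≤ 4 * K * ε := by
  have hre : LipschitzOnWith K (fun t => (ψ t).re) (Icc (-ε) ε) := by
    rw [← one_mul K]
    exact (RCLike.lipschitzWith_re (K := ℂ)).comp_lipschitzOnWith hψ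
  have him : LipschitzOnWith K (fun t => (ψ t).im) (Icc (-ε) ε) := by
    rw [← one_mul K]
    exact (RCLike.lipschitzWith_im (K := ℂ)).comp_lipschitzOnWith hψ
  set g₀ : ℝ → ℂ := fun t => (deriv (fun t => (ψ t).re) t : ℝ)
    + (deriv (fun t => (ψ t).im) t : ℝ) * Complex.I
  have hbound : ∀ᵐ t ∂weightMeasure ε, ‖g₀ t‖ ≤ 2 * K := by
    refine (weightMeasure_absolutelyContinuous ε).ae_le ?_
    rw [← restrict_Ioo_eq_restrict_Icc]
    filter_upwards [ae_restrict_mem measurableSet_Ioo] with t ht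
    have hnhds := Icc_mem_nhds ht.1 ht.2
    refine (norm_add_le _ _).trans ?_
    rw [norm_mul, Complex.norm_I, mul_one, Complex.norm_real, Complex.norm_real, two_mul]
    exact add_le_add (norm_deriv_le_of_lipschitzOn hnhds hre)
      (norm_deriv_le_of_lipschitzOn hnhds him)
  have hmem : MemLp g₀ 2 (weightMeasure ε) :=
    MemLp.of_bound (by fun_prop) _ hbound
  refine ⟨hmem.toLp g₀, fun x y => ?_, ?_⟩
  · have hsub := (convex_Icc (-ε) ε).ordConnected.uIcc_subset x.2 y.2
    have hre' := (hre.mono hsub).absolutelyContinuousOnInterval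
    have him' := (him.mono hsub).absolutelyContinuousOnInterval
    rw [integral_congr_of_ae_restrict_Icc ((absolutelyContinuous_weightMeasure ε).ae_le
      hmem.coeFn_toLp), intervalIntegral.integral_add (intervalIntegrable_ofReal_deriv hre')
      ((intervalIntegrable_ofReal_deriv him').mul_const _), intervalIntegral.integral_mul_const,
      intervalIntegral.integral_ofReal, intervalIntegral.integral_ofReal,
      hre'.integral_deriv_eq_sub, him'.integral_deriv_eq_sub]
    apply Complex.ext <;> simp
  · refine (norm_le_of_ae_norm_le hε.le (by positivity) ?_).trans_eq
      (by ring : 2 * ε * (2 * K) = 4 * K * ε)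
    filter_upwards [hmem.coeFn_toLp, hbound] with t ht hb
    rwa [ht]

lemma domRestrict_mem_Y (hε : 0 < ε) (hψ : LipschitzOnWith K ψ (Icc (-ε) ε)) :
    (fun y : Icc (-ε) ε => ψ y) ∈ Y ε := by
  obtain ⟨g, hg, -⟩ := exists_sub_eq_integral_of_lipschitzOnWith hε hψ
  exact ⟨continuous_of_sub_eq_integral hε hg, g, hg⟩

end LipschitzPrimitive

section LogBounds

variable {ε : ℝ}

lemma one_le_sqrt_pi : 1 ≤ √Real.pi := Real.one_le_sqrt.2 (by linarith [Real.pi_gt_three])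

lemma sqrt_pi_le_two : √Real.pi ≤ 2 :=
  Real.sqrt_le_left (by norm_num) |>.2 (by linarith [Real.pi_le_four])

lemma log_div_two_eq (hε : 0 < ε) : Real.log (ε / 2) = Real.log ε - Real.log 2 :=
  Real.log_div hε.ne' two_ne_zero

lemma abs_log_le_abs_logConst (hε : 0 < ε) (hε1 : ε < 1) : |Real.log ε| ≤ |logConst ε| := by
  have hlog := Real.log_neg hε hε1
  rw [abs_of_neg hlog, abs_of_neg (logConst_neg hε (by linarith)), logConst, log_div_two_eq hε]
  nlinarith [Real.log_pos one_lt_two, one_le_sqrt_pi]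

lemma one_le_abs_logConst (hε : 0 < ε) (hε1 : ε < 1) : 1 ≤ |logConst ε| := by
  have hlog := Real.log_neg hε hε1
  have hpi : 1.5 ≤ √Real.pi := Real.le_sqrt_of_sq_le (by linarith [Real.pi_gt_three])
  rw [abs_of_neg (logConst_neg hε (by linarith)), logConst, log_div_two_eq hε]
  nlinarith [Real.log_two_gt_d9]

lemma mul_abs_log_le_one (hε : 0 < ε) (hε1 : ε ≤ 1) : ε * |Real.log ε| ≤ 1 := by
  simpa only [abs_mul, abs_of_pos hε, mul_comm] using (Real.abs_log_mul_self_lt ε hε hε1).le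

lemma mul_abs_log_sq_le_four (hε : 0 < ε) (hε1 : ε ≤ 1) : ε * |Real.log ε| ^ 2 ≤ 4 := by
  have h := mul_abs_log_le_one (Real.sqrt_pos.2 hε) (Real.sqrt_le_one.2 hε1)
  rw [Real.log_sqrt hε.le, abs_div, abs_two] at h
  calc ε * |Real.log ε| ^ 2 = 4 * (√ε * (|Real.log ε| / 2)) ^ 2 := by
        rw [mul_pow, Real.sq_sqrt hε.le]
        ring
    _ ≤ 4 * 1 ^ 2 := by gcongr
    _ = 4 := by norm_num

lemma abs_div_log_div_two_sub_le (hε : 0 < ε) (hε1 : ε < 1) {s : ℝ} (hs : 0 ≤ s) :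
    |s / Real.log (ε / 2) - s / Real.log ε| ≤ s / |Real.log ε| ^ 2 := by
  have hlog := Real.log_neg hε hε1
  have hlog2 := Real.log_pos one_lt_two
  have hlt : Real.log (ε / 2) < Real.log ε := by linarith [log_div_two_eq hε]
  have hdiff : s / Real.log (ε / 2) - s / Real.log ε
      = s * Real.log 2 / (Real.log (ε / 2) * Real.log ε) := by
    rw [div_sub_div _ _ (hlt.trans hlog).ne hlog.ne, log_div_two_eq hε]
    ring
  have habs : |Real.log ε| ≤ |Real.log (ε / 2)| := by
    rw [abs_of_neg hlog, abs_of_neg (hlt.trans hlog)]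
    linarith
  have hmul : s * Real.log 2 ≤ s := mul_le_of_le_one_right hs (by linarith [Real.log_two_lt_d9])
  have hpos : 0 < |Real.log ε| := abs_pos.2 hlog.ne
  rw [hdiff, abs_div, abs_mul, abs_mul, abs_of_nonneg hs, abs_of_pos hlog2, sq]
  exact div_le_div₀ hs hmul (by positivity) (by gcongr)

end LogBounds

section Asymptotics

variable {ε S : ℝ} {K : ℝ≥0} {ψ : ℝ → ℂ}

lemma pairing_eq_inner (hε : 0 < ε)
    (hψ : MemLp (fun y => ψ y / weight ε y) 2 (weightMeasure ε)) (f : X ε) :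
    pairing ε f ψ = inner ℂ f (divWeight ψ hψ) := by
  rw [← inner_conj_symm, inner_divWeight_left, pairing,
    intervalIntegral.integral_of_le (by linarith), ← integral_Icc_eq_integral_Ioc, ← integral_conj]
  simp only [map_mul, Complex.conj_conj, mul_comm]

lemma norm_pairing_le (hε : 0 < ε) (hψ : LipschitzOnWith K ψ (Icc (-ε) ε))
    (hS : ∀ y ∈ Icc (-ε) ε, ‖ψ y‖ ≤ S) (f : X ε) : ‖pairing ε f ψ‖ ≤ 2 * S * ‖f‖ := by
  have hmeas := hψ.continuousOn.aestronglyMeasurable (μ := volume) measurableSet_Icc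
  have hS0 : 0 ≤ S := (norm_nonneg _).trans (hS 0 ⟨by linarith, hε.le⟩)
  rw [pairing_eq_inner hε (memLp_div_weight hε hmeas hS)]
  calc ‖inner ℂ f (divWeight ψ (memLp_div_weight hε hmeas hS))‖ ≤ ‖f‖ * (S * √Real.pi) :=
        (norm_inner_le_norm _ _).trans (by gcongr; exact norm_divWeight_le hε hmeas hS)
    _ ≤ ‖f‖ * (S * 2) := by gcongr; exact sqrt_pi_le_two
    _ = 2 * S * ‖f‖ := by ring

lemma norm_sub_apply_zero_le (hψ : LipschitzOnWith K ψ (Icc (-ε) ε)) {y : ℝ}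
    (hy : y ∈ Icc (-ε) ε) : ‖ψ y - ψ 0‖ ≤ K * ε := by
  have hε : 0 ≤ ε := by linarith [hy.1, hy.2]
  refine (hψ.norm_sub_le hy ⟨by linarith, hε⟩).trans ?_
  gcongr
  rw [sub_zero]
  exact abs_le.2 hy

lemma inner_vecT_zero_divWeight_const (hε : 0 < ε) (c : ℂ)
    (hc : MemLp (fun y => c / weight ε y) 2 (weightMeasure ε)) :
    inner ℂ (vecT hε 0) (divWeight (fun _ => c) hc) = √Real.pi * c := by
  have hint : ∫ y in Icc (-ε) ε, divWeight (fun _ => c) hc y = Real.pi * c := by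
    rw [integral_congr_ae (coeFn_divWeight hc), ← integral_inv_weight hε, ← integral_complex_ofReal,
      ← integral_mul_const]
    simp only [Complex.ofReal_inv, div_eq_inv_mul]
  have hsq : (√Real.pi : ℂ) * √Real.pi = Real.pi := by
    exact_mod_cast Real.mul_self_sqrt Real.pi_pos.le
  have hne : (√Real.pi : ℂ) ≠ 0 := by exact_mod_cast (Real.sqrt_pos.2 Real.pi_pos).ne'
  simp only [inner_vecT_left, orthoT_zero, integral_smul, hint]
  rw [Complex.real_smul, Complex.ofReal_inv, ← hsq]
  field_simp

lemma norm_pairing_vecT_zero_sub_le (hε : 0 < ε) (hψ : LipschitzOnWith K ψ (Icc (-ε) ε)) :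
    ‖pairing ε (vecT hε 0) ψ - √Real.pi * ψ 0‖ ≤ 2 * K * ε := by
  have hmeas := hψ.continuousOn.aestronglyMeasurable (μ := volume) measurableSet_Icc
  obtain ⟨S, hS⟩ := isCompact_Icc.exists_bound_of_continuousOn hψ.continuousOn
  have hψ_mem := memLp_div_weight hε hmeas hS
  have hc_mem := memLp_div_weight (k := fun _ => ψ 0) hε aestronglyMeasurable_const
    fun _ _ => le_rfl
  have hdiff_meas := hmeas.sub (aestronglyMeasurable_const (b := ψ 0))
  have hdiff := fun y hy => norm_sub_apply_zero_le hψ (y := y) hy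
  have hsub : divWeight ψ hψ_mem - divWeight (fun _ => ψ 0) hc_mem
      = divWeight (fun y => ψ y - ψ 0) (memLp_div_weight hε hdiff_meas hdiff) := by
    rw [divWeight, divWeight, divWeight, ← MemLp.toLp_sub]
    exact MemLp.toLp_congr _ _ (Eventually.of_forall fun y => (sub_div _ _ _).symm)
  rw [pairing_eq_inner hε hψ_mem, ← inner_vecT_zero_divWeight_const hε _ hc_mem, ← inner_sub_right,
    hsub]
  calc _ ≤ ‖vecT hε 0‖ * ‖divWeight (fun y => ψ y - ψ 0)
          (memLp_div_weight hε hdiff_meas hdiff)‖ := norm_inner_le_norm _ _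
    _ ≤ 1 * (K * ε * √Real.pi) := by
        rw [(orthonormal_vecT hε).1]
        gcongr
        exact norm_divWeight_le hε hdiff_meas hdiff
    _ ≤ 1 * (K * ε * 2) := by gcongr; exact sqrt_pi_le_two
    _ = 2 * K * ε := by ring

lemma exists_Linv_eq_smul_add (hε : 0 < ε) (hε1 : ε < 1) (hψ : LipschitzOnWith K ψ (Icc (-ε) ε)) :
    ∃ f : X ε, Linv ε (fun y => ψ y) = (ψ 0 / logConst ε) • vecT hε 0 + f ∧
      ‖f‖ ≤ 20 * K * ε := by
  obtain ⟨g, hg, hg_norm⟩ := exists_sub_eq_integral_of_lipschitzOnWith hε hψ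
  have hzero : (0 : ℝ) ∈ Icc (-ε) ε := ⟨by linarith, hε.le⟩
  have hLinv := Linv_eq_logInverse hε (by linarith) hg ⟨0, hzero⟩
  have hpi : ‖(Real.pi : ℂ)⁻¹‖ = Real.pi⁻¹ := by
    rw [norm_inv, Complex.norm_real, Real.norm_of_nonneg Real.pi_pos.le]
  set c : ℂ := (Real.pi : ℂ)⁻¹ * L ε (shiftIsometry hε g) ⟨0, hzero⟩ with hc_def
  have hc : ‖c / logConst ε‖ ≤ 4 * ‖g‖ := by
    rw [norm_div, Complex.norm_real, Real.norm_eq_abs]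
    calc ‖c‖ / |logConst ε| ≤ ‖c‖ := div_le_self (norm_nonneg _) (one_le_abs_logConst hε hε1)
      _ ≤ Real.pi⁻¹ * (Real.pi ^ 2 * ‖g‖) := by
          rw [hc_def, norm_mul, hpi]
          gcongr
          exact norm_L_shiftIsometry_le hε g _
      _ = Real.pi * ‖g‖ := by field_simp
      _ ≤ 4 * ‖g‖ := by gcongr; exact Real.pi_le_four
  have hpi_le : ‖-(Real.pi : ℂ)⁻¹‖ ≤ 1 := by
    rw [norm_neg, hpi]
    exact inv_le_one_of_one_le₀ (by linarith [Real.pi_gt_three])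
  refine ⟨(c / logConst ε) • vecT hε 0 + (-(Real.pi : ℂ)⁻¹) • shiftIsometry hε g, ?_, ?_⟩
  · rw [hLinv, logInverse, ← hc_def, add_div, add_smul, add_assoc]
  · refine (norm_add_le _ _).trans ?_
    calc _ ≤ 4 * ‖g‖ * 1 + 1 * ‖g‖ := by
          rw [norm_smul, norm_smul, (orthonormal_vecT hε).1, LinearIsometry.norm_map]
          gcongr
      _ ≤ 20 * K * ε := by linarith

lemma norm_div_logConst_le (hε : 0 < ε) (hε1 : ε < 1) (z : ℂ) :
    ‖z / logConst ε‖ ≤ ‖z‖ / |Real.log ε| := by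
  rw [norm_div, Complex.norm_real, Real.norm_eq_abs]
  exact div_le_div_of_nonneg_left (norm_nonneg z) (abs_pos.2 (Real.log_neg hε hε1).ne)
    (abs_log_le_abs_logConst hε hε1)

lemma conj_div_logConst_mul (z : ℂ) :
    conj (z / logConst ε) * (√Real.pi * z) = (‖z‖ ^ 2 / Real.log (ε / 2) : ℝ) := by
  have hne : (√Real.pi : ℂ) ≠ 0 := by exact_mod_cast (Real.sqrt_pos.2 Real.pi_pos).ne'
  rw [map_div₀, Complex.conj_ofReal, logConst]
  push_cast
  rw [← Complex.conj_mul', div_mul_eq_mul_div, mul_left_comm, mul_div_mul_left _ _ hne]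

theorem norm_pairing_Linv_sub_le (hε : 0 < ε) (hε1 : ε < 1)
    (hψ : LipschitzOnWith K ψ (Icc (-ε) ε)) (hS : ∀ y ∈ Icc (-ε) ε, ‖ψ y‖ ≤ S) :
    ‖pairing ε (Linv ε fun y => ψ y) ψ - ((‖ψ 0‖ ^ 2 / Real.log ε : ℝ) : ℂ)‖
      ≤ (S ^ 2 + 168 * S * K) / |Real.log ε| ^ 2 := by
  have h0 : ‖ψ 0‖ ≤ S := hS 0 ⟨by linarith, hε.le⟩
  have hS0 : 0 ≤ S := (norm_nonneg _).trans h0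
  have hlog : 0 < |Real.log ε| := abs_pos.2 (Real.log_neg hε hε1).ne
  obtain ⟨f, hf, hf_norm⟩ := exists_Linv_eq_smul_add hε hε1 hψ
  set a : ℂ := ψ 0 / logConst ε
  have ha : ‖a‖ ≤ S := by
    rw [norm_div, Complex.norm_real, Real.norm_eq_abs]
    exact (div_le_self (norm_nonneg _) (one_le_abs_logConst hε hε1)).trans h0
  have hmeas := hψ.continuousOn.aestronglyMeasurable (μ := volume) measurableSet_Icc
  have hsplit : pairing ε (a • vecT hε 0 + f : X ε) ψ
      = conj a * pairing ε (vecT hε 0) ψ + pairing ε f ψ := by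
    simp only [pairing_eq_inner hε (memLp_div_weight hε hmeas hS), inner_add_left, inner_smul_left]
  have hlead : ‖((‖ψ 0‖ ^ 2 / Real.log (ε / 2) : ℝ) : ℂ) - (‖ψ 0‖ ^ 2 / Real.log ε : ℝ)‖
      ≤ S ^ 2 / |Real.log ε| ^ 2 := by
    rw [← Complex.ofReal_sub, Complex.norm_real, Real.norm_eq_abs]
    exact (abs_div_log_div_two_sub_le hε hε1 (sq_nonneg _)).trans (by gcongr)
  have hosc : ‖conj a * (pairing ε (vecT hε 0) ψ - √Real.pi * ψ 0)‖ ≤ S * (2 * K * ε) := by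
    rw [norm_mul, RCLike.norm_conj]
    gcongr
    exact norm_pairing_vecT_zero_sub_le hε hψ
  have hrest : ‖pairing ε f ψ‖ ≤ 2 * S * (20 * K * ε) :=
    (norm_pairing_le hε hψ hS f).trans (by gcongr)
  have hε4 : ε ≤ 4 / |Real.log ε| ^ 2 := by
    rw [le_div_iff₀ (by positivity)]
    exact mul_abs_log_sq_le_four hε hε1.le
  calc ‖pairing ε (Linv ε fun y => ψ y) ψ - ((‖ψ 0‖ ^ 2 / Real.log ε : ℝ) : ℂ)‖
      = ‖(((‖ψ 0‖ ^ 2 / Real.log (ε / 2) : ℝ) : ℂ) - (‖ψ 0‖ ^ 2 / Real.log ε : ℝ))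
          + conj a * (pairing ε (vecT hε 0) ψ - √Real.pi * ψ 0) + pairing ε f ψ‖ := by
        rw [hf, hsplit, ← conj_div_logConst_mul]
        congr 1
        ring
    _ ≤ S ^ 2 / |Real.log ε| ^ 2 + S * (2 * K * ε) + 2 * S * (20 * K * ε) :=
        norm_add₃_le.trans (by gcongr)
    _ = S ^ 2 / |Real.log ε| ^ 2 + 42 * S * K * ε := by ring
    _ ≤ S ^ 2 / |Real.log ε| ^ 2 + 42 * S * K * (4 / |Real.log ε| ^ 2) := by gcongr
    _ = (S ^ 2 + 168 * S * K) / |Real.log ε| ^ 2 := by ring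

theorem norm_pairing_apply_Linv_le (hε : 0 < ε) (hε1 : ε < 1)
    (hψ : LipschitzOnWith K ψ (Icc (-ε) ε)) (hS : ∀ y ∈ Icc (-ε) ε, ‖ψ y‖ ≤ S)
    (B : X ε →L[ℂ] X ε) :
    ‖pairing ε (B (Linv ε fun y => ψ y)) ψ‖ ≤ 2 * S * (S + 20 * K) * ‖B‖ / |Real.log ε| := by
  have h0 : ‖ψ 0‖ ≤ S := hS 0 ⟨by linarith, hε.le⟩
  have hS0 : 0 ≤ S := (norm_nonneg _).trans h0
  have hlog : 0 < |Real.log ε| := abs_pos.2 (Real.log_neg hε hε1).ne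
  obtain ⟨f, hf, hf_norm⟩ := exists_Linv_eq_smul_add hε hε1 hψ
  have hε_le : ε ≤ 1 / |Real.log ε| := by
    rw [le_div_iff₀ hlog]
    exact mul_abs_log_le_one hε hε1.le
  have hLinv : ‖Linv ε fun y => ψ y‖ ≤ (S + 20 * K) / |Real.log ε| := by
    calc ‖Linv ε fun y => ψ y‖ ≤ ‖ψ 0 / logConst ε‖ * ‖vecT hε 0‖ + ‖f‖ := by
          rw [hf, ← norm_smul]
          exact norm_add_le _ _
      _ ≤ S / |Real.log ε| * 1 + 20 * K * (1 / |Real.log ε|) := by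
          rw [(orthonormal_vecT hε).1]
          gcongr
          · exact (norm_div_logConst_le hε hε1 _).trans (by gcongr)
          · exact hf_norm.trans (by gcongr)
      _ = (S + 20 * K) / |Real.log ε| := by ring
  calc ‖pairing ε (B (Linv ε fun y => ψ y)) ψ‖
      ≤ 2 * S * ‖B (Linv ε fun y => ψ y)‖ := norm_pairing_le hε hψ hS _
    _ ≤ 2 * S * (‖B‖ * ((S + 20 * K) / |Real.log ε|)) := by
        gcongr
        exact B.le_opNorm_of_le hLinv
    _ = 2 * S * (S + 20 * K) * ‖B‖ / |Real.log ε| := by ring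

end Asymptotics

section WeakFormulation

/-- `u` solves the weak form of the Neumann problem `-Δu = E u` in `U`: a Neumann eigenfunction,
except that `u = 0` is allowed. -/
def IsNeumannSolution (U : Set (ℝ × ℝ)) (E : ℝ) (u : ℝ × ℝ → ℂ) : Prop :=
  ∃ g₁ g₂ : ℝ × ℝ → ℂ, HasH1Gradient U u g₁ g₂ ∧
    ∀ v h₁ h₂ : ℝ × ℝ → ℂ, HasH1Gradient U v h₁ h₂ →
      ∫ p in U, (conj (h₁ p) * g₁ p + conj (h₂ p) * g₂ p) = E * ∫ p in U, conj (v p) * u p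

/-- `g` is the weak derivative of `u` in `U` in the direction `e`. -/
def HasWeakDeriv (U : Set (ℝ × ℝ)) (u g : ℝ × ℝ → ℂ) (e : ℝ × ℝ) : Prop :=
  ∀ φ : ℝ × ℝ → ℂ, ContDiff ℝ ∞ φ → HasCompactSupport φ → tsupport φ ⊆ U →
    ∫ p in U, u p * fderiv ℝ φ p e = -∫ p in U, g p * φ p

/-- Near the point `(c, 0)` the set `U` is the half-plane `0 < σ (x - c)`. Balls of `ℝ × ℝ` are
squares. -/
structure IsHalfPlaneNear (U : Set (ℝ × ℝ)) (c σ r : ℝ) : Prop where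
  ne_zero : σ ≠ 0
  mem_iff : ∀ p ∈ Metric.ball ((c, 0) : ℝ × ℝ) r, p ∈ U ↔ 0 < σ * (p.1 - c)

variable {U : Set (ℝ × ℝ)} {v w : ℝ × ℝ → ℝ}

lemma IsNeumannSolution.memLp {E : ℝ} {u : ℝ × ℝ → ℂ} (hu : IsNeumannSolution U E u) :
    MemLp u 2 (volume.restrict U) :=
  let ⟨_, _, hgrad, _⟩ := hu
  hgrad.memLp

lemma contDiff_ofReal_comp (hv : ContDiff ℝ ∞ v) : ContDiff ℝ ∞ (fun p => (v p : ℂ)) :=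
  Complex.ofRealCLM.contDiff.comp hv

lemma hasCompactSupport_ofReal_comp (hv : HasCompactSupport v) :
    HasCompactSupport (fun p => (v p : ℂ)) :=
  hv.comp_left (g := fun x : ℝ => (x : ℂ)) Complex.ofReal_zero

lemma fderiv_ofReal_comp (hv : Differentiable ℝ v) (p e : ℝ × ℝ) :
    fderiv ℝ (fun q => (v q : ℂ)) p e = (fderiv ℝ v p e : ℂ) := by
  have h : HasFDerivAt (fun q => (v q : ℂ)) (Complex.ofRealCLM.comp (fderiv ℝ v p)) p :=
    Complex.ofRealCLM.hasFDerivAt.comp p (hv p).hasFDerivAt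
  rw [h.fderiv]
  rfl

lemma contDiff_fderiv_apply (hv : ContDiff ℝ ∞ v) (e : ℝ × ℝ) :
    ContDiff ℝ ∞ (fun p => fderiv ℝ v p e) :=
  (hv.fderiv_right (m := ∞) (by norm_cast)).clm_apply contDiff_const

lemma memLp_ofReal_comp (hv : ContDiff ℝ ∞ v) (hvc : HasCompactSupport v) :
    MemLp (fun p => (v p : ℂ)) 2 (volume.restrict U) :=
  ((contDiff_ofReal_comp hv).continuous.memLp_of_hasCompactSupport
    (hasCompactSupport_ofReal_comp hvc)).restrict U

lemma hasWeakDeriv_of_contDiff (hv : ContDiff ℝ ∞ v) (hvc : HasCompactSupport v) (e : ℝ × ℝ) :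
    HasWeakDeriv U (fun p => (v p : ℂ)) (fun p => (fderiv ℝ v p e : ℂ)) e := by
  intro φ hφ hφc hφU
  have hvd := hv.differentiable (by norm_num)
  have hvC := contDiff_ofReal_comp hv
  have hv' : Continuous fun p => (fderiv ℝ v p e : ℂ) :=
    (contDiff_ofReal_comp (contDiff_fderiv_apply hv e)).continuous
  have hφ' : Continuous fun p => fderiv ℝ φ p e :=
    (hφ.continuous_fderiv (by norm_num)).clm_apply continuous_const
  rw [setIntegral_eq_integral_of_forall_compl_eq_zero fun p hp => ?_,
    setIntegral_eq_integral_of_forall_compl_eq_zero fun p hp => ?_]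
  · have hparts := integral_mul_fderiv_eq_neg_fderiv_mul_of_integrable (μ := volume)
      (f := fun p => (v p : ℂ)) (g := φ) (v := e)
    simp only [fderiv_ofReal_comp hvd] at hparts
    exact hparts ((hv'.mul hφ.continuous).integrable_of_hasCompactSupport hφc.mul_left)
      ((hvC.continuous.mul hφ').integrable_of_hasCompactSupport
        (hasCompactSupport_ofReal_comp hvc).mul_right)
      ((hvC.continuous.mul hφ.continuous).integrable_of_hasCompactSupport hφc.mul_left)
      (fun p _ => hvC.differentiable (by norm_num) p)
      (fun p _ => hφ.differentiable (by norm_num) p)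
  · rw [image_eq_zero_of_notMem_tsupport (fun h => hp (hφU h)), mul_zero]
  · rw [fderiv_of_notMem_tsupport ℝ (fun h => hp (hφU h)), _root_.zero_apply, mul_zero]

lemma hasH1Gradient_of_contDiff (U : Set (ℝ × ℝ)) (hv : ContDiff ℝ ∞ v)
    (hvc : HasCompactSupport v) :
    HasH1Gradient U (fun p => (v p : ℂ)) (fun p => (fderiv ℝ v p (1, 0) : ℂ))
      (fun p => (fderiv ℝ v p (0, 1) : ℂ)) where
  memLp := memLp_ofReal_comp hv hvc
  memLp_fst := memLp_ofReal_comp (contDiff_fderiv_apply hv _) (hvc.fderiv_apply ℝ _)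
  memLp_snd := memLp_ofReal_comp (contDiff_fderiv_apply hv _) (hvc.fderiv_apply ℝ _)
  weak_fst := hasWeakDeriv_of_contDiff hv hvc _
  weak_snd := hasWeakDeriv_of_contDiff hv hvc _

lemma exists_abs_mul_deriv_smoothTransition_le :
    ∃ D : ℝ, ∀ x, |x * deriv Real.smoothTransition (x - 1)| ≤ D := by
  have hcont : Continuous (deriv Real.smoothTransition) :=
    (Real.smoothTransition.contDiff (n := 1)).continuous_deriv le_rfl
  have hsupp : HasCompactSupport (deriv Real.smoothTransition) := by
    refine HasCompactSupport.intro (isCompact_Icc (a := 0) (b := 1)) fun x hx => ?_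
    rcases not_and_or.1 hx with h | h
    · have : Real.smoothTransition =ᶠ[𝓝 x] fun _ => 0 := by
        filter_upwards [gt_mem_nhds (not_le.1 h)] with y hy
        exact Real.smoothTransition.zero_of_nonpos hy.le
      rw [this.deriv_eq, deriv_const]
    · have : Real.smoothTransition =ᶠ[𝓝 x] fun _ => 1 := by
        filter_upwards [lt_mem_nhds (not_le.1 h)] with y hy
        exact Real.smoothTransition.one_of_one_le hy.le
      rw [this.deriv_eq, deriv_const]
  have hmul : Continuous fun y => (y + 1) * deriv Real.smoothTransition y :=
    (continuous_id.add continuous_const).mul hcont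
  obtain ⟨D, hD⟩ := hmul.bounded_above_of_compact_support hsupp.mul_left
  exact ⟨D, fun x => by simpa using hD (x - 1)⟩

/-- A smooth cutoff that vanishes for `σ (x - c) ≤ 1 / s` and equals `1` for
`σ (x - c) ≥ 2 / s`. -/
def sideCutoff (c σ s : ℝ) (p : ℝ × ℝ) : ℝ := Real.smoothTransition (s * (σ * (p.1 - c)) - 1)

lemma contDiff_sideCutoff (c σ s : ℝ) : ContDiff ℝ ∞ (sideCutoff c σ s) :=
  Real.smoothTransition.contDiff.comp (by fun_prop)

lemma abs_sideCutoff_le_one (c σ s : ℝ) (p : ℝ × ℝ) : |sideCutoff c σ s p| ≤ 1 :=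
  (abs_of_nonneg (Real.smoothTransition.nonneg _)).trans_le (Real.smoothTransition.le_one _)

lemma fderiv_sideCutoff (c σ s : ℝ) (p e : ℝ × ℝ) :
    fderiv ℝ (sideCutoff c σ s) p e
      = deriv Real.smoothTransition (s * (σ * (p.1 - c)) - 1) * (s * (σ * e.1)) := by
  have hlin : HasFDerivAt (fun q : ℝ × ℝ => s * (σ * (q.1 - c)) - 1)
      (s • (σ • ContinuousLinearMap.fst ℝ ℝ ℝ)) p :=
    ((((ContinuousLinearMap.fst ℝ ℝ ℝ).hasFDerivAt.sub_const c).const_mul σ).const_mul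
      s).sub_const 1
  have hsmooth := (Real.smoothTransition.contDiff (n := 1)).differentiable (by norm_num)
    (s * (σ * (p.1 - c)) - 1)
  have hcomp : HasFDerivAt (sideCutoff c σ s) _ p := hsmooth.hasDerivAt.comp_hasFDerivAt p hlin
  rw [hcomp.fderiv]
  simp

lemma abs_mul_fderiv_sideCutoff_le {D a : ℝ} {C : ℝ≥0} {c : ℝ} {p e : ℝ × ℝ}
    (hD : ∀ x, |x * deriv Real.smoothTransition (x - 1)| ≤ D)
    (ha : |a| * |e.1| ≤ C * |p.1 - c|) (σ s : ℝ) :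
    |a * fderiv ℝ (sideCutoff c σ s) p e| ≤ C * D := by
  rw [fderiv_sideCutoff]
  set d := deriv Real.smoothTransition (s * (σ * (p.1 - c)) - 1)
  calc |a * (d * (s * (σ * e.1)))|
      = |a| * |e.1| * |s * σ * d| := by rw [← abs_mul, ← abs_mul]; congr 1; ring
    _ ≤ C * |p.1 - c| * |s * σ * d| := by gcongr
    _ = C * |s * (σ * (p.1 - c)) * d| := by rw [mul_assoc, ← abs_mul]; congr 2; ring
    _ ≤ C * D := by gcongr; exact hD _

lemma tsupport_sideCutoff_mul_subset {c σ r s : ℝ} (hU : IsHalfPlaneNear U c σ r)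
    (hwU : tsupport w ⊆ Metric.ball (c, 0) r) (hs : 0 < s) :
    tsupport (fun p => sideCutoff c σ s p * w p) ⊆ U := by
  have hclosed : IsClosed {q : ℝ × ℝ | 1 ≤ s * (σ * (q.1 - c))} :=
    isClosed_le continuous_const (by fun_prop)
  have hside : tsupport (sideCutoff c σ s) ⊆ {q | 1 ≤ s * (σ * (q.1 - c))} := by
    refine closure_minimal (fun q hq => ?_) hclosed
    by_contra hlt
    simp only [mem_ofPred_eq, not_le] at hlt
    exact hq (Real.smoothTransition.zero_of_nonpos (by linarith))
  intro p hp
  have hpos : 1 ≤ s * (σ * (p.1 - c)) := hside (tsupport_mul_subset_left hp)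
  exact (hU.mem_iff p (hwU (tsupport_mul_subset_right hp))).2
    ((pos_iff_pos_of_mul_pos (zero_lt_one.trans_le hpos)).1 hs)

lemma eventually_sideCutoff_eq_one {c σ : ℝ} {p : ℝ × ℝ} (hp : 0 < σ * (p.1 - c)) :
    ∀ᶠ n : ℕ in atTop, sideCutoff c σ (n + 1) p = 1 ∧ fderiv ℝ (sideCutoff c σ (n + 1)) p = 0 := by
  have hlim : Tendsto (fun n : ℕ => ((n : ℝ) + 1) * (σ * (p.1 - c))) atTop atTop :=
    (tendsto_atTop_add_const_right _ _ tendsto_natCast_atTop_atTop).atTop_mul_const hp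
  filter_upwards [hlim.eventually_gt_atTop 2] with n hn
  have hone : sideCutoff c σ (n + 1) =ᶠ[𝓝 p] fun _ => 1 := by
    have hopen : IsOpen {q : ℝ × ℝ | 2 < ((n : ℝ) + 1) * (σ * (q.1 - c))} :=
      isOpen_lt continuous_const (by fun_prop)
    filter_upwards [hopen.mem_nhds hn] with q (hq : 2 < ((n : ℝ) + 1) * (σ * (q.1 - c)))
    exact Real.smoothTransition.one_of_one_le (by linarith)
  exact ⟨hone.eq_of_nhds, by rw [hone.fderiv_eq, fderiv_fun_const]; rfl⟩

lemma tendsto_integral_mul_ofReal {α : Type*} [MeasurableSpace α] {μ : Measure α} {s : Set α}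
    {f : α → ℂ} {h : ℕ → α → ℝ} {h₀ : α → ℝ} {M : ℝ} (hf : MemLp f 2 μ) (hs : MeasurableSet s)
    (hμs : μ s ≠ ⊤) (hh : ∀ n, AEStronglyMeasurable (h n) μ) (hle : ∀ n, ∀ x ∈ s, |h n x| ≤ M)
    (hzero : ∀ n, ∀ x ∉ s, h n x = 0) (hzero₀ : ∀ x ∉ s, h₀ x = 0)
    (hlim : ∀ᵐ x ∂μ, x ∈ s → ∀ᶠ n in atTop, h n x = h₀ x) :
    Tendsto (fun n => ∫ x, f x * (h n x : ℂ) ∂μ) atTop (𝓝 (∫ x, f x * (h₀ x : ℂ) ∂μ)) := by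
  have hM : MemLp (s.indicator fun _ => M) 2 μ := memLp_indicator_const 2 hs M (Or.inr hμs)
  have hle' (n : ℕ) (x : α) : |h n x| ≤ s.indicator (fun _ => M) x := by
    by_cases hx : x ∈ s
    · rw [indicator_of_mem hx]
      exact hle n x hx
    · rw [indicator_of_notMem hx, hzero n x hx, abs_zero]
  refine tendsto_integral_of_dominated_convergence (fun x => ‖f x‖ * s.indicator (fun _ => M) x)
    (fun n => hf.1.mul (Complex.continuous_ofReal.comp_aestronglyMeasurable (hh n)))
    (hf.norm.integrable_mul hM) (fun n => Eventually.of_forall fun x => ?_) ?_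
  · rw [norm_mul, Complex.norm_real]
    exact mul_le_mul_of_nonneg_left (hle' n x) (norm_nonneg _)
  · filter_upwards [hlim] with x hx
    refine tendsto_const_nhds.congr' ?_
    by_cases hxs : x ∈ s
    · filter_upwards [hx hxs] with n hn
      rw [hn]
    · exact Eventually.of_forall fun n => by simp only [hzero n x hxs, hzero₀ x hxs]

lemma integral_mul_fderiv_sideCutoff_mul {c σ r s : ℝ} (hU : IsHalfPlaneNear U c σ r)
    {u g : ℝ × ℝ → ℂ} {e : ℝ × ℝ} (hweak : HasWeakDeriv U u g e) (hw : ContDiff ℝ ∞ w)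
    (hwc : HasCompactSupport w) (hwU : tsupport w ⊆ Metric.ball (c, 0) r) (hs : 0 < s) :
    ∫ p in U, u p * ((sideCutoff c σ s p * fderiv ℝ w p e
        + w p * fderiv ℝ (sideCutoff c σ s) p e : ℝ) : ℂ)
      = -∫ p in U, g p * ((sideCutoff c σ s p * w p : ℝ) : ℂ) := by
  have hηw := (contDiff_sideCutoff c σ s).mul hw
  rw [← hweak _ (contDiff_ofReal_comp hηw) (hasCompactSupport_ofReal_comp hwc.mul_left)
    ((tsupport_comp_subset Complex.ofReal_zero _).trans
      (tsupport_sideCutoff_mul_subset hU hwU hs))]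
  congr 1 with p
  rw [fderiv_ofReal_comp (hηw.differentiable (by norm_num)),
    fderiv_fun_mul ((contDiff_sideCutoff c σ s).differentiable (by norm_num) p)
      (hw.differentiable (by norm_num) p)]
  simp

/-- Test functions may reach the flat part of the boundary if they vanish there to first order or
if the derivative is tangential: both are covered by the bound on `w p * e.1`. -/
lemma integral_mul_fderiv_eq_of_halfPlane {c σ r : ℝ} {C : ℝ≥0} (hUm : MeasurableSet U)
    (hU : IsHalfPlaneNear U c σ r) {u g : ℝ × ℝ → ℂ} {e : ℝ × ℝ}
    (hu : MemLp u 2 (volume.restrict U)) (hg : MemLp g 2 (volume.restrict U))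
    (hweak : HasWeakDeriv U u g e) (hw : ContDiff ℝ ∞ w) (hwc : HasCompactSupport w)
    (hwU : tsupport w ⊆ Metric.ball (c, 0) r) (hC : ∀ p, |w p| * |e.1| ≤ C * |p.1 - c|) :
    ∫ p in U, u p * (fderiv ℝ w p e : ℂ) = -∫ p in U, g p * (w p : ℂ) := by
  obtain ⟨D, hD⟩ := exists_abs_mul_deriv_smoothTransition_le
  obtain ⟨W, hW⟩ := hw.continuous.bounded_above_of_compact_support hwc
  have hw' := contDiff_fderiv_apply hw e
  obtain ⟨W', hW'⟩ := hw'.continuous.bounded_above_of_compact_support (hwc.fderiv_apply ℝ e)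
  have hη (n : ℕ) := contDiff_sideCutoff c σ (n + 1)
  have hmeas := (isClosed_tsupport w).measurableSet
  have hfin : volume.restrict U (tsupport w) ≠ ⊤ :=
    ((Measure.restrict_apply_le _ _).trans_lt hwc.isCompact.measure_lt_top).ne
  have hη_le {a b : ℝ} (hab : |a| ≤ b) (n : ℕ) (p : ℝ × ℝ) :
      |sideCutoff c σ (n + 1) p * a| ≤ b := by
    rw [abs_mul]
    exact (mul_le_of_le_one_left (abs_nonneg _) (abs_sideCutoff_le_one _ _ _ _)).trans hab
  have hout {p : ℝ × ℝ} (hp : p ∉ tsupport w) : w p = 0 ∧ fderiv ℝ w p = 0 :=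
    ⟨image_eq_zero_of_notMem_tsupport hp, fderiv_of_notMem_tsupport ℝ hp⟩
  have hη_eventually : ∀ᵐ p ∂volume.restrict U, p ∈ tsupport w → ∀ᶠ n : ℕ in atTop,
      sideCutoff c σ (n + 1) p = 1 ∧ fderiv ℝ (sideCutoff c σ (n + 1)) p = 0 := by
    filter_upwards [ae_restrict_mem hUm] with p hp hpw
    exact eventually_sideCutoff_eq_one ((hU.mem_iff p (hwU hpw)).1 hp)
  have hlim_g := tendsto_integral_mul_ofReal (h₀ := w)
    (h := fun n p => sideCutoff c σ (n + 1) p * w p) hg hmeas hfin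
    (fun n => ((hη n).mul hw).continuous.aestronglyMeasurable) (fun n p _ => hη_le (hW p) n p)
    (fun n p hp => by simp [hout hp]) (fun p hp => (hout hp).1)
    (hη_eventually.mono fun p hη_p hp => (hη_p hp).mono fun n hn => by rw [hn.1, one_mul])
  have hlim_u := tendsto_integral_mul_ofReal (h₀ := fun p => fderiv ℝ w p e)
    (h := fun n p => sideCutoff c σ (n + 1) p * fderiv ℝ w p e
      + w p * fderiv ℝ (sideCutoff c σ (n + 1)) p e) hu hmeas hfin
    (fun n => (((hη n).mul hw').add
      (hw.mul (contDiff_fderiv_apply (hη n) e))).continuous.aestronglyMeasurable)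
    (fun n p _ => (abs_add_le _ _).trans
      (add_le_add (hη_le (hW' p) n p) (abs_mul_fderiv_sideCutoff_le hD (hC p) _ _)))
    (fun n p hp => by simp [hout hp]) (fun p hp => by simp [hout hp])
    (hη_eventually.mono fun p hη_p hp => (hη_p hp).mono fun n hn => by simp [hn])
  refine tendsto_nhds_unique hlim_u (hlim_g.neg.congr fun n => ?_)
  exact (integral_mul_fderiv_sideCutoff_mul hU hweak hw hwc hwU n.cast_add_one_pos).symm

end WeakFormulation

section Laplacian

/-- The Laplacian of a smooth function of two real variables. -/
def laplacian (v : ℝ × ℝ → ℝ) (p : ℝ × ℝ) : ℝ :=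
  fderiv ℝ (fun q => fderiv ℝ v q (1, 0)) p (1, 0)
    + fderiv ℝ (fun q => fderiv ℝ v q (0, 1)) p (0, 1)

variable {f g v : ℝ × ℝ → ℝ}

lemma contDiff_laplacian (hv : ContDiff ℝ ∞ v) : ContDiff ℝ ∞ (laplacian v) :=
  (contDiff_fderiv_apply (contDiff_fderiv_apply hv _) _).add
    (contDiff_fderiv_apply (contDiff_fderiv_apply hv _) _)

lemma tsupport_laplacian_subset (v : ℝ × ℝ → ℝ) : tsupport (laplacian v) ⊆ tsupport v :=
  (tsupport_add _ _).trans (union_subset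
    ((tsupport_fderiv_apply_subset ℝ _).trans (tsupport_fderiv_apply_subset ℝ _))
    ((tsupport_fderiv_apply_subset ℝ _).trans (tsupport_fderiv_apply_subset ℝ _)))

lemma fderiv_mul_apply (hf : ContDiff ℝ ∞ f) (hg : ContDiff ℝ ∞ g) (p e : ℝ × ℝ) :
    fderiv ℝ (fun q => f q * g q) p e = fderiv ℝ f p e * g p + f p * fderiv ℝ g p e := by
  rw [fderiv_fun_mul (hf.differentiable (by norm_num) p) (hg.differentiable (by norm_num) p)]
  simp only [_root_.add_apply, _root_.smul_apply, smul_eq_mul]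
  ring

lemma fderiv_fderiv_mul_apply (hf : ContDiff ℝ ∞ f) (hg : ContDiff ℝ ∞ g) (p e : ℝ × ℝ) :
    fderiv ℝ (fun q => fderiv ℝ (fun q => f q * g q) q e) p e
      = fderiv ℝ (fun q => fderiv ℝ f q e) p e * g p + 2 * (fderiv ℝ f p e * fderiv ℝ g p e)
        + f p * fderiv ℝ (fun q => fderiv ℝ g q e) p e := by
  have hf' := contDiff_fderiv_apply hf e
  have hg' := contDiff_fderiv_apply hg e
  simp only [fderiv_mul_apply hf hg]
  rw [fderiv_fun_add ((hf'.mul hg).differentiable (by norm_num) p)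
    ((hf.mul hg').differentiable (by norm_num) p), _root_.add_apply, fderiv_mul_apply hf' hg,
    fderiv_mul_apply hf hg']
  ring

lemma laplacian_mul (hf : ContDiff ℝ ∞ f) (hg : ContDiff ℝ ∞ g) (p : ℝ × ℝ) :
    laplacian (fun q => f q * g q) p
      = laplacian f p * g p
        + 2 * (fderiv ℝ f p (1, 0) * fderiv ℝ g p (1, 0)
          + fderiv ℝ f p (0, 1) * fderiv ℝ g p (0, 1))
        + f p * laplacian g p := by
  simp only [laplacian, fderiv_fderiv_mul_apply hf hg]
  ring

lemma integral_mul_laplacian_add_eq_zero {U : Set (ℝ × ℝ)} {c σ r E : ℝ} {C : ℝ≥0}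
    {u : ℝ × ℝ → ℂ} (hUm : MeasurableSet U) (hU : IsHalfPlaneNear U c σ r)
    (hu : IsNeumannSolution U E u) (hv : ContDiff ℝ ∞ v) (hvc : HasCompactSupport v)
    (hvU : tsupport v ⊆ Metric.ball (c, 0) r)
    (hC : ∀ p, |fderiv ℝ v p (1, 0)| ≤ C * |p.1 - c|) :
    ∫ p in U, u p * ((laplacian v p + E * v p : ℝ) : ℂ) = 0 := by
  obtain ⟨g₁, g₂, hgrad, heq⟩ := hu
  have hv' (e : ℝ × ℝ) := contDiff_fderiv_apply hv e
  have hvc' (e : ℝ × ℝ) : HasCompactSupport fun q => fderiv ℝ v q e := hvc.fderiv_apply ℝ e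
  have hvU' (e : ℝ × ℝ) : tsupport (fun q => fderiv ℝ v q e) ⊆ Metric.ball (c, 0) r :=
    (tsupport_fderiv_apply_subset ℝ e).trans hvU
  have hint {f : ℝ × ℝ → ℂ} {w : ℝ × ℝ → ℝ} (hf : MemLp f 2 (volume.restrict U))
      (hw : ContDiff ℝ ∞ w) (hwc : HasCompactSupport w) :
      IntegrableOn (fun p => f p * (w p : ℂ)) U :=
    hf.integrable_mul (memLp_ofReal_comp hw hwc)
  have hfst := integral_mul_fderiv_eq_of_halfPlane hUm hU hgrad.memLp hgrad.memLp_fst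
    hgrad.weak_fst (hv' _) (hvc' _) (hvU' (1, 0)) (fun p => by simpa using hC p)
  have hsnd := integral_mul_fderiv_eq_of_halfPlane (C := 0) hUm hU hgrad.memLp hgrad.memLp_snd
    hgrad.weak_snd (hv' _) (hvc' _) (hvU' (0, 1)) (fun p => by simp)
  have hform := heq _ _ _ (hasH1Gradient_of_contDiff U hv hvc)
  simp only [Complex.conj_ofReal, mul_comm (Complex.ofReal _)] at hform
  rw [integral_add (hint hgrad.memLp_fst (hv' _) (hvc' _))
    (hint hgrad.memLp_snd (hv' _) (hvc' _))] at hform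
  have hint_fst := hint hgrad.memLp (contDiff_fderiv_apply (hv' (1, 0)) (1, 0))
    ((hvc' _).fderiv_apply ℝ _)
  have hint_snd := hint hgrad.memLp (contDiff_fderiv_apply (hv' (0, 1)) (0, 1))
    ((hvc' _).fderiv_apply ℝ _)
  calc ∫ p in U, u p * ((laplacian v p + E * v p : ℝ) : ℂ)
      = (∫ p in U, u p * (fderiv ℝ (fun q => fderiv ℝ v q (1, 0)) p (1, 0) : ℂ))
        + (∫ p in U, u p * (fderiv ℝ (fun q => fderiv ℝ v q (0, 1)) p (0, 1) : ℂ))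
        + E * ∫ p in U, u p * (v p : ℂ) := by
        rw [← integral_const_mul, ← integral_add hint_fst hint_snd,
          ← integral_add ?_ ((hint hgrad.memLp hv hvc).const_mul _)]
        · congr 1 with p
          rw [laplacian]
          push_cast
          ring
        · exact hint_fst.add hint_snd
    _ = 0 := by
        rw [hfst, hsnd]
        linear_combination -hform

end Laplacian

section LogPotential

/-- `χ` is a smooth cutoff, equal to `1` near `(c, 0)` and with vanishing normal derivative on the
line `x = c`. Balls of `ℝ × ℝ` are squares. -/
structure IsCutoff (χ : ℝ × ℝ → ℝ) (c ρ : ℝ) : Prop where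
  contDiff : ContDiff ℝ ∞ χ
  eq_one : ∀ p ∈ Metric.closedBall ((c, 0) : ℝ × ℝ) ρ, χ p = 1
  tsupport_subset : tsupport χ ⊆ Metric.closedBall (c, 0) (2 * ρ)
  fderiv_normal : ∀ y, fderiv ℝ χ (c, y) (1, 0) = 0

/-- The regularized squared distance to the point `(c, t)`. -/
def distSq (c t δ : ℝ) (p : ℝ × ℝ) : ℝ := (p.1 - c) ^ 2 + (p.2 - t) ^ 2 + δ ^ 2

/-- A localized and regularized logarithmic potential with pole at `(c, t)`. -/
def logPotential (χ : ℝ × ℝ → ℝ) (c t δ : ℝ) (p : ℝ × ℝ) : ℝ :=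
  χ p * Real.log (distSq c t δ p)

/-- The part of `Δ v + E v` without a singularity of order two at `(c, t)`, where `v` is the
localized logarithmic potential. -/
def remainder (χ : ℝ × ℝ → ℝ) (E c t δ : ℝ) (p : ℝ × ℝ) : ℝ :=
  (laplacian χ p + E * χ p) * Real.log (distSq c t δ p)
    + 4 * (fderiv ℝ χ p (1, 0) * ((p.1 - c) / distSq c t δ p)
      + fderiv ℝ χ p (0, 1) * ((p.2 - t) / distSq c t δ p))

variable {χ : ℝ × ℝ → ℝ} {c t δ ρ : ℝ}

lemma exists_isCutoff (c : ℝ) (hρ : 0 < ρ) : ∃ χ, IsCutoff χ c ρ := by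
  let b : ContDiffBump (0 : ℝ) := ⟨ρ, 2 * ρ, hρ, by linarith⟩
  have hb : ContDiff ℝ ∞ b := b.contDiff
  have hb₁ : ContDiff ℝ ∞ fun p : ℝ × ℝ => b (p.1 - c) := hb.comp (by fun_prop)
  have hb₂ : ContDiff ℝ ∞ fun p : ℝ × ℝ => b p.2 := hb.comp (by fun_prop)
  refine ⟨fun p => b (p.1 - c) * b p.2, hb₁.mul hb₂, fun p hp => ?_, ?_, fun y => ?_⟩
  · simp only [Metric.mem_closedBall, Prod.dist_eq, Real.dist_eq, sup_le_iff, sub_zero] at hp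
    rw [b.one_of_mem_closedBall (by simpa using hp.1),
      b.one_of_mem_closedBall (by simpa using hp.2), mul_one]
  · refine closure_minimal (fun p hp => ?_) Metric.isClosed_closedBall
    simp only [Metric.mem_closedBall, Prod.dist_eq, Real.dist_eq, sup_le_iff, sub_zero]
    by_contra hfar
    rcases not_and_or.1 hfar with h | h
    · exact hp (by simp only [b.zero_of_le_dist (by simpa using (not_le.1 h).le), zero_mul])
    · exact hp (by simp only [b.zero_of_le_dist (by simpa using (not_le.1 h).le), mul_zero])
  · have hone : (fun p : ℝ × ℝ => b (p.1 - c)) =ᶠ[𝓝 (c, y)] fun _ => 1 := by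
      have hcont : Tendsto (fun p : ℝ × ℝ => p.1 - c) (𝓝 (c, y)) (𝓝 0) :=
        Continuous.tendsto' (by fun_prop) _ _ (sub_self c)
      exact hcont.eventually b.eventuallyEq_one
    have hzero : fderiv ℝ (fun p : ℝ × ℝ => b p.2) (c, y) (1, 0) = 0 := by
      have h := (hb.differentiable (by norm_num) y).hasDerivAt.comp_hasFDerivAt (c, y)
        (ContinuousLinearMap.snd ℝ ℝ ℝ).hasFDerivAt
      change fderiv ℝ (b ∘ ContinuousLinearMap.snd ℝ ℝ ℝ) (c, y) (1, 0) = 0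
      rw [h.fderiv]
      simp
    rw [fderiv_mul_apply hb₁ hb₂, hone.fderiv_eq, hzero]
    simp

lemma distSq_pos (hδ : 0 < δ) (c t : ℝ) (p : ℝ × ℝ) : 0 < distSq c t δ p := by
  unfold distSq; positivity

lemma contDiff_log_distSq (hδ : 0 < δ) (c t : ℝ) :
    ContDiff ℝ ∞ fun p => Real.log (distSq c t δ p) := by
  refine ContDiff.log ?_ fun p => (distSq_pos hδ c t p).ne'
  unfold distSq
  fun_prop

lemma contDiff_logPotential (hχ : IsCutoff χ c ρ) (hδ : 0 < δ) (t : ℝ) :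
    ContDiff ℝ ∞ (logPotential χ c t δ) :=
  hχ.contDiff.mul (contDiff_log_distSq hδ c t)

lemma IsCutoff.hasCompactSupport (hχ : IsCutoff χ c ρ) : HasCompactSupport χ :=
  (isCompact_closedBall _ _).of_isClosed_subset (isClosed_tsupport _) hχ.tsupport_subset

lemma hasCompactSupport_logPotential (hχ : IsCutoff χ c ρ) (t δ : ℝ) :
    HasCompactSupport (logPotential χ c t δ) :=
  hχ.hasCompactSupport.mul_right

lemma hasFDerivAt_distSq (c t δ : ℝ) (p : ℝ × ℝ) :
    HasFDerivAt (distSq c t δ) ((2 * (p.1 - c)) • ContinuousLinearMap.fst ℝ ℝ ℝ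
      + (2 * (p.2 - t)) • ContinuousLinearMap.snd ℝ ℝ ℝ) p := by
  have h : HasFDerivAt (distSq c t δ) _ p :=
    ((((ContinuousLinearMap.fst ℝ ℝ ℝ).hasFDerivAt.sub_const c).pow 2).add
      (((ContinuousLinearMap.snd ℝ ℝ ℝ).hasFDerivAt.sub_const t).pow 2)).add_const _
  convert! h using 1
  simp

lemma fderiv_log_distSq (hδ : 0 < δ) (c t : ℝ) (p e : ℝ × ℝ) :
    fderiv ℝ (fun q => Real.log (distSq c t δ q)) p e
      = 2 * ((p.1 - c) * e.1 + (p.2 - t) * e.2) / distSq c t δ p := by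
  rw [((hasFDerivAt_distSq c t δ p).log (distSq_pos hδ c t p).ne').fderiv]
  simp only [_root_.smul_apply, _root_.add_apply, ContinuousLinearMap.coe_fst',
    ContinuousLinearMap.coe_snd', smul_eq_mul]
  ring

lemma fderiv_fderiv_log_distSq (hδ : 0 < δ) (c t : ℝ) (p e : ℝ × ℝ) :
    fderiv ℝ (fun q => fderiv ℝ (fun q => Real.log (distSq c t δ q)) q e) p e
      = 2 * (e.1 ^ 2 + e.2 ^ 2) / distSq c t δ p
        - 4 * ((p.1 - c) * e.1 + (p.2 - t) * e.2) ^ 2 / distSq c t δ p ^ 2 := by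
  have hpos := distSq_pos hδ c t p
  have hnum : HasFDerivAt (fun q : ℝ × ℝ => 2 * ((q.1 - c) * e.1 + (q.2 - t) * e.2)) _ p :=
    ((((ContinuousLinearMap.fst ℝ ℝ ℝ).hasFDerivAt.sub_const c).mul_const e.1).add
      (((ContinuousLinearMap.snd ℝ ℝ ℝ).hasFDerivAt.sub_const t).mul_const e.2)).const_mul 2
  simp only [fderiv_log_distSq hδ]
  have hinv : HasFDerivAt (fun q => (distSq c t δ q)⁻¹) _ p :=
    (hasDerivAt_inv hpos.ne').comp_hasFDerivAt p (hasFDerivAt_distSq c t δ p)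
  simp only [div_eq_mul_inv]
  rw [fderiv_fun_mul hnum.differentiableAt hinv.differentiableAt, hnum.fderiv, hinv.fderiv]
  simp only [_root_.smul_apply, _root_.add_apply, ContinuousLinearMap.coe_fst',
    ContinuousLinearMap.coe_snd', smul_eq_mul]
  field_simp
  ring

lemma laplacian_log_distSq (hδ : 0 < δ) (c t : ℝ) (p : ℝ × ℝ) :
    laplacian (fun q => Real.log (distSq c t δ q)) p = 4 * δ ^ 2 / distSq c t δ p ^ 2 := by
  have hpos := distSq_pos hδ c t p
  have hδ_sq : δ ^ 2 = distSq c t δ p - (p.1 - c) ^ 2 - (p.2 - t) ^ 2 := by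
    unfold distSq; ring
  rw [laplacian, fderiv_fderiv_log_distSq hδ, fderiv_fderiv_log_distSq hδ, hδ_sq]
  field_simp
  ring

lemma laplacian_logPotential_add (hχ : IsCutoff χ c ρ) (hδ : 0 < δ) (E t : ℝ) (p : ℝ × ℝ) :
    laplacian (logPotential χ c t δ) p + E * logPotential χ c t δ p
      = χ p * (4 * δ ^ 2 / distSq c t δ p ^ 2) + remainder χ E c t δ p := by
  have hmul : laplacian (logPotential χ c t δ) p = _ :=
    laplacian_mul hχ.contDiff (contDiff_log_distSq hδ c t) p
  rw [hmul, fderiv_log_distSq hδ, fderiv_log_distSq hδ, laplacian_log_distSq hδ, logPotential,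
    remainder]
  ring

lemma exists_abs_fderiv_logPotential_le (hχ : IsCutoff χ c ρ) (hδ : 0 < δ) (t : ℝ) :
    ∃ C : ℝ≥0, ∀ p, |fderiv ℝ (logPotential χ c t δ) p (1, 0)| ≤ C * |p.1 - c| := by
  obtain ⟨C, hC⟩ := ContDiff.lipschitzWith_of_hasCompactSupport
    ((hasCompactSupport_logPotential hχ t δ).fderiv_apply ℝ ((1, 0) : ℝ × ℝ))
    (contDiff_fderiv_apply (contDiff_logPotential hχ hδ t) (1, 0)) (by norm_num)
  refine ⟨C, fun p => ?_⟩
  have hnormal : fderiv ℝ (logPotential χ c t δ) (c, p.2) (1, 0) = 0 := by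
    have hmul : fderiv ℝ (logPotential χ c t δ) (c, p.2) (1, 0) = _ :=
      fderiv_mul_apply hχ.contDiff (contDiff_log_distSq hδ c t) _ _
    rw [hmul, hχ.fderiv_normal, fderiv_log_distSq hδ]
    simp
  have hdist := hC.dist_le_mul p (c, p.2)
  rw [hnormal, dist_zero_right, Real.norm_eq_abs] at hdist
  simpa [Prod.dist_eq, Real.dist_eq] using hdist

lemma integral_mul_add_remainder_eq_zero {U : Set (ℝ × ℝ)} {σ r E : ℝ} {u : ℝ × ℝ → ℂ}
    (hUm : MeasurableSet U) (hU : IsHalfPlaneNear U c σ r) (hu : IsNeumannSolution U E u)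
    (hχ : IsCutoff χ c ρ) (hρ : 2 * ρ < r) (hδ : 0 < δ) (t : ℝ) :
    ∫ p in U, u p * ((χ p * (4 * δ ^ 2 / distSq c t δ p ^ 2) + remainder χ E c t δ p : ℝ) : ℂ)
      = 0 := by
  obtain ⟨C, hC⟩ := exists_abs_fderiv_logPotential_le hχ hδ t
  have hsupp : tsupport (logPotential χ c t δ) ⊆ Metric.ball (c, 0) r :=
    tsupport_mul_subset_left.trans
      (hχ.tsupport_subset.trans (Metric.closedBall_subset_ball hρ))
  have hzero := integral_mul_laplacian_add_eq_zero hUm hU hu (contDiff_logPotential hχ hδ t)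
    (hasCompactSupport_logPotential hχ t δ) hsupp hC
  simpa only [laplacian_logPotential_add hχ hδ] using hzero

end LogPotential

section RemainderEstimate

variable {χ : ℝ × ℝ → ℝ} {c t s δ ρ : ℝ}

lemma log_sub_log_le {a b : ℝ} (ha : 0 < a) (hb : 0 < b) :
    Real.log a - Real.log b ≤ |a - b| * (a⁻¹ + b⁻¹) :=
  calc Real.log a - Real.log b = Real.log (a / b) := (Real.log_div ha.ne' hb.ne').symm
    _ ≤ a / b - 1 := Real.log_le_sub_one_of_pos (div_pos ha hb)
    _ = (a - b) * b⁻¹ := by field_simp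
    _ ≤ |a - b| * (a⁻¹ + b⁻¹) := by
        gcongr
        · exact le_abs_self _
        · exact le_add_of_nonneg_left (inv_nonneg.2 ha.le)

lemma abs_log_sub_log_le {a b : ℝ} (ha : 0 < a) (hb : 0 < b) :
    |Real.log a - Real.log b| ≤ |a - b| * (a⁻¹ + b⁻¹) := by
  refine abs_sub_le_iff.2 ⟨log_sub_log_le ha hb, ?_⟩
  rw [abs_sub_comm, add_comm]
  exact log_sub_log_le hb ha

lemma abs_snd_sub_le_sqrt_distSq (c t δ : ℝ) (p : ℝ × ℝ) : |p.2 - t| ≤ √(distSq c t δ p) := by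
  refine Real.abs_le_sqrt ?_
  unfold distSq
  nlinarith [sq_nonneg (p.1 - c), sq_nonneg δ]

lemma norm_sub_le_sqrt_distSq (c t δ : ℝ) (p : ℝ × ℝ) : ‖p - (c, t)‖ ≤ √(distSq c t δ p) := by
  refine max_le (Real.abs_le_sqrt ?_) (abs_snd_sub_le_sqrt_distSq c t δ p)
  simp only [distSq, Prod.fst_sub]
  nlinarith [sq_nonneg (p.2 - t), sq_nonneg δ]

lemma abs_sqrt_distSq_sub_le (hδ : 0 < δ) (c t s : ℝ) (p : ℝ × ℝ) :
    |√(distSq c t δ p) - √(distSq c s δ p)| ≤ |t - s| := by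
  have ht := Real.sqrt_pos.2 (distSq_pos hδ c t p)
  have hs := Real.sqrt_pos.2 (distSq_pos hδ c s p)
  refine le_of_mul_le_mul_right ?_ (add_pos ht hs)
  calc |√(distSq c t δ p) - √(distSq c s δ p)| * (√(distSq c t δ p) + √(distSq c s δ p))
      = |√(distSq c t δ p) ^ 2 - √(distSq c s δ p) ^ 2| := by
        rw [sq_sub_sq, abs_mul, abs_of_pos (add_pos ht hs), mul_comm]
    _ = |t - s| * |(p.2 - t) + (p.2 - s)| := by
        rw [Real.sq_sqrt (distSq_pos hδ c t p).le, Real.sq_sqrt (distSq_pos hδ c s p).le,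
          ← abs_mul, ← abs_neg]
        unfold distSq
        ring_nf
    _ ≤ |t - s| * (√(distSq c t δ p) + √(distSq c s δ p)) := by
        gcongr
        exact (abs_add_le _ _).trans (add_le_add (abs_snd_sub_le_sqrt_distSq c t δ p)
          (abs_snd_sub_le_sqrt_distSq c s δ p))

lemma abs_log_distSq_sub_le (hδ : 0 < δ) (c t s : ℝ) (p : ℝ × ℝ) :
    |Real.log (distSq c t δ p) - Real.log (distSq c s δ p)|
      ≤ 2 * |t - s| * ((√(distSq c t δ p))⁻¹ + (√(distSq c s δ p))⁻¹) := by
  have ht := Real.sqrt_pos.2 (distSq_pos hδ c t p)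
  have hs := Real.sqrt_pos.2 (distSq_pos hδ c s p)
  have hlog (τ : ℝ) : Real.log (distSq c τ δ p) = 2 * Real.log √(distSq c τ δ p) := by
    rw [Real.log_sqrt (distSq_pos hδ c τ p).le]
    ring
  rw [hlog, hlog, ← mul_sub, abs_mul, abs_two, mul_assoc]
  gcongr
  exact (abs_log_sub_log_le ht hs).trans
    (mul_le_mul_of_nonneg_right (abs_sqrt_distSq_sub_le hδ c t s p) (by positivity))

lemma abs_mul_div_mul_le {a b m n : ℝ} (ha : 0 < a) (hb : 0 < b) (hn : |n| ≤ a + b) :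
    |m * (n / (a * b))| ≤ |m| * (a⁻¹ + b⁻¹) := by
  have hinv : a⁻¹ + b⁻¹ = (a + b) / (a * b) := by
    field_simp
    ring
  rw [hinv, abs_mul, abs_div, abs_of_pos (mul_pos ha hb)]
  gcongr

lemma abs_fst_div_distSq_sub_le (hδ : 0 < δ) (c t s : ℝ) (p : ℝ × ℝ) :
    |(p.1 - c) / distSq c t δ p - (p.1 - c) / distSq c s δ p|
      ≤ |t - s| * ((distSq c t δ p)⁻¹ + (distSq c s δ p)⁻¹) := by
  have ht := distSq_pos hδ c t p
  have hs := distSq_pos hδ c s p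
  have hnum : |(p.1 - c) * ((p.2 - t) + (p.2 - s))| ≤ distSq c t δ p + distSq c s δ p := by
    unfold distSq
    rw [abs_le]
    constructor <;>
      nlinarith [sq_nonneg (p.1 - c + (p.2 - t)), sq_nonneg (p.1 - c + (p.2 - s)),
        sq_nonneg (p.1 - c - (p.2 - t)), sq_nonneg (p.1 - c - (p.2 - s)), sq_nonneg δ]
  have hdiff : (p.1 - c) / distSq c t δ p - (p.1 - c) / distSq c s δ p
      = (t - s) * ((p.1 - c) * ((p.2 - t) + (p.2 - s)) / (distSq c t δ p * distSq c s δ p)) := by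
    field_simp
    unfold distSq
    ring
  rw [hdiff]
  exact abs_mul_div_mul_le ht hs hnum

lemma abs_snd_div_distSq_sub_le (hδ : 0 < δ) (c t s : ℝ) (p : ℝ × ℝ) :
    |(p.2 - t) / distSq c t δ p - (p.2 - s) / distSq c s δ p|
      ≤ |t - s| * ((distSq c t δ p)⁻¹ + (distSq c s δ p)⁻¹) := by
  have ht := distSq_pos hδ c t p
  have hs := distSq_pos hδ c s p
  have hnum : |(p.2 - t) * (p.2 - s) - ((p.1 - c) ^ 2 + δ ^ 2)|
      ≤ distSq c t δ p + distSq c s δ p := by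
    unfold distSq
    rw [abs_le]
    constructor <;>
      nlinarith [sq_nonneg (p.2 - t + (p.2 - s)), sq_nonneg (p.2 - t - (p.2 - s)),
        sq_nonneg (p.1 - c), sq_nonneg δ]
  have hdiff : (p.2 - t) / distSq c t δ p - (p.2 - s) / distSq c s δ p
      = (t - s) * (((p.2 - t) * (p.2 - s) - ((p.1 - c) ^ 2 + δ ^ 2))
        / (distSq c t δ p * distSq c s δ p)) := by
    field_simp
    unfold distSq
    ring
  rw [hdiff]
  exact abs_mul_div_mul_le ht hs hnum

lemma IsCutoff.fderiv_eq_zero (hχ : IsCutoff χ c ρ) {p : ℝ × ℝ}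
    (hp : p ∈ Metric.ball ((c, 0) : ℝ × ℝ) ρ) : fderiv ℝ χ p = 0 := by
  have hone : χ =ᶠ[𝓝 p] fun _ => 1 :=
    (Metric.isOpen_ball.eventually_mem hp).mono fun q hq =>
      hχ.eq_one q (Metric.ball_subset_closedBall hq)
  rw [hone.fderiv_eq, fderiv_const_apply]

lemma half_le_sqrt_distSq (ht : |t| ≤ ρ / 2) {p : ℝ × ℝ}
    (hp : p ∉ Metric.ball ((c, 0) : ℝ × ℝ) ρ) : ρ / 2 ≤ √(distSq c t δ p) := by
  refine le_trans ?_ (norm_sub_le_sqrt_distSq c t δ p)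
  rw [← dist_eq_norm]
  have htri := dist_triangle p (c, t) (c, 0)
  have hct : dist ((c, t) : ℝ × ℝ) (c, 0) ≤ ρ / 2 := by simpa [Prod.dist_eq] using ht
  have hdist : ρ ≤ dist p (c, 0) := not_lt.1 fun h => hp (Metric.mem_ball.2 h)
  linarith

/-- Off the ball where the gradient of the cutoff vanishes, the pole is at distance `≥ ρ / 2`. -/
lemma abs_fderiv_mul_inv_distSq_le (hχ : IsCutoff χ c ρ) (hρ : 0 < ρ) (hδ : 0 < δ)
    (ht : |t| ≤ ρ / 2) (p e : ℝ × ℝ) :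
    |fderiv ℝ χ p e| * (distSq c t δ p)⁻¹
      ≤ |fderiv ℝ χ p e| * (2 / ρ) * (√(distSq c t δ p))⁻¹ := by
  by_cases hp : p ∈ Metric.ball ((c, 0) : ℝ × ℝ) ρ
  · simp [hχ.fderiv_eq_zero hp]
  have hhalf : ρ / 2 ≤ √(distSq c t δ p) := half_le_sqrt_distSq ht hp
  have hinv : (√(distSq c t δ p))⁻¹ ≤ 2 / ρ := by
    rw [← inv_div]
    gcongr
  have hsq : (distSq c t δ p)⁻¹ = (√(distSq c t δ p))⁻¹ * (√(distSq c t δ p))⁻¹ := by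
    rw [← mul_inv, Real.mul_self_sqrt (distSq_pos hδ c t p).le]
  rw [hsq, mul_assoc]
  gcongr

lemma remainder_eq_zero (hχ : IsCutoff χ c ρ) (E t δ : ℝ) {p : ℝ × ℝ}
    (hp : p ∉ Metric.closedBall ((c, 0) : ℝ × ℝ) (2 * ρ)) : remainder χ E c t δ p = 0 := by
  have hsupp : p ∉ tsupport χ := fun h => hp (hχ.tsupport_subset h)
  have hlap : laplacian χ p = 0 :=
    image_eq_zero_of_notMem_tsupport fun h => hsupp (tsupport_laplacian_subset χ h)
  simp [remainder, hlap, image_eq_zero_of_notMem_tsupport hsupp,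
    fderiv_of_notMem_tsupport (𝕜 := ℝ) hsupp]

lemma abs_remainder_sub_le (hχ : IsCutoff χ c ρ) (hρ : 0 < ρ) (hδ : 0 < δ) (E : ℝ)
    (ht : |t| ≤ ρ / 2) (hs : |s| ≤ ρ / 2) (p : ℝ × ℝ) :
    |remainder χ E c t δ p - remainder χ E c s δ p|
      ≤ (2 * |laplacian χ p + E * χ p|
          + 8 / ρ * (|fderiv ℝ χ p (1, 0)| + |fderiv ℝ χ p (0, 1)|))
        * |t - s| * ((√(distSq c t δ p))⁻¹ + (√(distSq c s δ p))⁻¹) := by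
  have hgrad (e : ℝ × ℝ) {d : ℝ}
      (hd : |d| ≤ |t - s| * ((distSq c t δ p)⁻¹ + (distSq c s δ p)⁻¹)) :
      |fderiv ℝ χ p e * d| ≤ |fderiv ℝ χ p e| * (2 / ρ) * |t - s|
        * ((√(distSq c t δ p))⁻¹ + (√(distSq c s δ p))⁻¹) :=
    calc |fderiv ℝ χ p e * d|
        ≤ |t - s| * (|fderiv ℝ χ p e| * (distSq c t δ p)⁻¹
          + |fderiv ℝ χ p e| * (distSq c s δ p)⁻¹) := by
          rw [abs_mul, ← mul_add, mul_left_comm]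
          gcongr
      _ ≤ |t - s| * (|fderiv ℝ χ p e| * (2 / ρ) * (√(distSq c t δ p))⁻¹
          + |fderiv ℝ χ p e| * (2 / ρ) * (√(distSq c s δ p))⁻¹) := by
          gcongr |t - s| * (?_ + ?_)
          · exact abs_fderiv_mul_inv_distSq_le hχ hρ hδ ht p e
          · exact abs_fderiv_mul_inv_distSq_le hχ hρ hδ hs p e
      _ = _ := by ring
  have hlog := mul_le_mul_of_nonneg_left (abs_log_distSq_sub_le hδ c t s p)
    (abs_nonneg (laplacian χ p + E * χ p))
  rw [← abs_mul] at hlog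
  have hfst := hgrad (1, 0) (abs_fst_div_distSq_sub_le hδ c t s p)
  have hsnd := hgrad (0, 1) (abs_snd_div_distSq_sub_le hδ c t s p)
  have hsplit : remainder χ E c t δ p - remainder χ E c s δ p
      = (laplacian χ p + E * χ p) * (Real.log (distSq c t δ p) - Real.log (distSq c s δ p))
        + 4 * (fderiv ℝ χ p (1, 0) * ((p.1 - c) / distSq c t δ p - (p.1 - c) / distSq c s δ p)
          + fderiv ℝ χ p (0, 1) * ((p.2 - t) / distSq c t δ p - (p.2 - s) / distSq c s δ p)) := by
    unfold remainder
    ring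
  rw [hsplit]
  refine (abs_add_le _ _).trans ?_
  rw [abs_mul 4, abs_of_pos (four_pos : (0 : ℝ) < 4)]
  have htri := abs_add_le
    (fderiv ℝ χ p (1, 0) * ((p.1 - c) / distSq c t δ p - (p.1 - c) / distSq c s δ p))
    (fderiv ℝ χ p (0, 1) * ((p.2 - t) / distSq c t δ p - (p.2 - s) / distSq c s δ p))
  linear_combination hlog + 4 * htri + 4 * hfst + 4 * hsnd

lemma exists_abs_remainder_sub_le (hχ : IsCutoff χ c ρ) (hρ : 0 < ρ) (E : ℝ) :
    ∃ D : ℝ≥0, ∀ δ t s : ℝ, 0 < δ → |t| ≤ ρ / 2 → |s| ≤ ρ / 2 → ∀ p,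
      |remainder χ E c t δ p - remainder χ E c s δ p|
        ≤ D * |t - s| * ((√(distSq c t δ p))⁻¹ + (√(distSq c s δ p))⁻¹) := by
  have hbound {w : ℝ × ℝ → ℝ} (hw : ContDiff ℝ ∞ w) (hwc : HasCompactSupport w) :
      ∃ A : ℝ≥0, ∀ p, |w p| ≤ A := by
    obtain ⟨A, hA⟩ := hwc.exists_bound_of_continuous hw.continuous
    exact ⟨A.toNNReal, fun p => (hA p).trans (le_max_left _ _)⟩
  have hlap : HasCompactSupport (laplacian χ) :=
    hχ.hasCompactSupport.mono' ((subset_tsupport _).trans (tsupport_laplacian_subset χ))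
  obtain ⟨A₀, hA₀⟩ := hbound ((contDiff_laplacian hχ.contDiff).add (hχ.contDiff.const_smul E))
    (hlap.add (hχ.hasCompactSupport.smul_left (f := fun _ => E)))
  obtain ⟨A₁, hA₁⟩ := hbound (contDiff_fderiv_apply hχ.contDiff (1, 0))
    (hχ.hasCompactSupport.fderiv_apply ℝ _)
  obtain ⟨A₂, hA₂⟩ := hbound (contDiff_fderiv_apply hχ.contDiff (0, 1))
    (hχ.hasCompactSupport.fderiv_apply ℝ _)
  refine ⟨2 * A₀ + 8 / ρ.toNNReal * (A₁ + A₂), fun δ t s hδ ht hs p =>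
    (abs_remainder_sub_le hχ hρ hδ E ht hs p).trans ?_⟩
  push_cast [Real.coe_toNNReal ρ hρ.le]
  gcongr
  · exact hA₀ p
  · exact hA₁ p
  · exact hA₂ p

lemma integrableOn_inv_norm (r : ℝ) :
    IntegrableOn (fun p : ℝ × ℝ => ‖p‖⁻¹) (Metric.closedBall 0 r) := by
  refine (locallyIntegrable_of_norm_le_rpow (C := 1) (α := 1) (by simp) (by simp)
    (Eventually.of_forall fun p => ?_) ?_).integrableOn_isCompact (isCompact_closedBall _ _)
  · rw [norm_inv, norm_norm, Real.rpow_neg_one, one_mul]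
  · exact measurable_norm.inv.aestronglyMeasurable

lemma integrableOn_inv_sqrt_distSq (hδ : 0 < δ) (c t : ℝ) {K : Set (ℝ × ℝ)} (hK : IsCompact K) :
    IntegrableOn (fun p => (√(distSq c t δ p))⁻¹) K := by
  refine (Continuous.inv₀ (Real.continuous_sqrt.comp ?_) fun p =>
    (Real.sqrt_pos.2 (distSq_pos hδ c t p)).ne').continuousOn.integrableOn_compact hK
  unfold distSq
  fun_prop

lemma setIntegral_inv_sqrt_distSq_le (hδ : 0 < δ) (ht : |t| ≤ ρ) :
    ∫ p in Metric.closedBall ((c, 0) : ℝ × ℝ) (2 * ρ), (√(distSq c t δ p))⁻¹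
      ≤ ∫ p in Metric.closedBall (0 : ℝ × ℝ) (3 * ρ), ‖p‖⁻¹ := by
  have htranslate := measurePreserving_sub_right (volume : Measure (ℝ × ℝ)) (c, t)
  have hemb := (MeasurableEquiv.subRight ((c, t) : ℝ × ℝ)).measurableEmbedding
  have hpre : (fun p => p - (c, t)) ⁻¹' Metric.closedBall (0 : ℝ × ℝ) (3 * ρ)
      = Metric.closedBall (c, t) (3 * ρ) := by
    ext p
    simp [dist_eq_norm]
  have hint : IntegrableOn (fun p => ‖p - (c, t)‖⁻¹) (Metric.closedBall (c, t) (3 * ρ)) := by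
    have h := (htranslate.integrableOn_comp_preimage hemb).2 (integrableOn_inv_norm (3 * ρ))
    rwa [hpre] at h
  have hsub : Metric.closedBall ((c, 0) : ℝ × ℝ) (2 * ρ) ⊆ Metric.closedBall (c, t) (3 * ρ) := by
    refine Metric.closedBall_subset_closedBall' ?_
    have : dist ((c, 0) : ℝ × ℝ) (c, t) ≤ ρ := by simpa [Prod.dist_eq, Real.dist_eq] using ht
    linarith
  have hne : ∀ᵐ p : ℝ × ℝ, p ≠ (c, t) := by simp [ae_iff]
  calc ∫ p in Metric.closedBall ((c, 0) : ℝ × ℝ) (2 * ρ), (√(distSq c t δ p))⁻¹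
      ≤ ∫ p in Metric.closedBall ((c, 0) : ℝ × ℝ) (2 * ρ), ‖p - (c, t)‖⁻¹ := by
        refine setIntegral_mono_ae (integrableOn_inv_sqrt_distSq hδ c t
          (isCompact_closedBall _ _)) (hint.mono_set hsub) ?_
        filter_upwards [hne] with p hp
        gcongr
        · exact norm_sub_pos_iff.2 hp
        · exact norm_sub_le_sqrt_distSq c t δ p
    _ ≤ ∫ p in Metric.closedBall ((c, t) : ℝ × ℝ) (3 * ρ), ‖p - (c, t)‖⁻¹ :=
        setIntegral_mono_set hint (Eventually.of_forall fun p => by positivity)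
          (Eventually.of_forall hsub)
    _ = ∫ p in Metric.closedBall (0 : ℝ × ℝ) (3 * ρ), ‖p‖⁻¹ := by
        rw [← htranslate.setIntegral_preimage_emb hemb (fun p => ‖p‖⁻¹), hpre]

lemma norm_setIntegral_mul_ofReal_le {α : Type*} [MeasurableSpace α] {μ : Measure α}
    {U B : Set α} {u : α → ℂ} {f b : α → ℝ} {S : ℝ} (hU : MeasurableSet U) (hB : MeasurableSet B)
    (hS : 0 ≤ S) (hu : ∀ p ∈ U ∩ B, ‖u p‖ ≤ S) (hf : ∀ p ∉ B, f p = 0) (hfb : ∀ p, |f p| ≤ b p)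
    (hb : IntegrableOn b B μ) :
    ‖∫ p in U, u p * (f p : ℂ) ∂μ‖ ≤ S * ∫ p in B, b p ∂μ := by
  have hlocal : ∫ p in U, u p * (f p : ℂ) ∂μ = ∫ p in U ∩ B, u p * (f p : ℂ) ∂μ :=
    setIntegral_eq_of_subset_of_forall_sdiff_eq_zero hU inter_subset_left fun p hp => by
      simp [hf p fun h => hp.2 ⟨hp.1, h⟩]
  have hb0 (p : α) : 0 ≤ b p := (abs_nonneg _).trans (hfb p)
  calc ‖∫ p in U, u p * (f p : ℂ) ∂μ‖ ≤ ∫ p in U ∩ B, S * b p ∂μ := by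
        rw [hlocal]
        refine norm_integral_le_of_norm_le ((hb.mono_set inter_subset_right).const_mul S)
          (ae_restrict_of_forall_mem (hU.inter hB) fun p hp => ?_)
        rw [norm_mul, Complex.norm_real, Real.norm_eq_abs]
        exact mul_le_mul (hu p hp) (hfb p) (abs_nonneg _) hS
    _ = S * ∫ p in U ∩ B, b p ∂μ := integral_const_mul _ _
    _ ≤ S * ∫ p in B, b p ∂μ := by
        gcongr ?_ * ?_
        exact setIntegral_mono_set hb (Eventually.of_forall hb0)
          (Eventually.of_forall inter_subset_right)

lemma exists_norm_integral_remainder_sub_le {U : Set (ℝ × ℝ)} {u : ℝ × ℝ → ℂ} {S : ℝ≥0}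
    (hUm : MeasurableSet U) (hχ : IsCutoff χ c ρ) (hρ : 0 < ρ) (E : ℝ)
    (hS : ∀ p ∈ U ∩ Metric.closedBall (c, 0) (2 * ρ), ‖u p‖ ≤ S) :
    ∃ M : ℝ≥0, ∀ δ t s : ℝ, 0 < δ → |t| ≤ ρ / 2 → |s| ≤ ρ / 2 →
      ‖∫ p in U, u p * ((remainder χ E c t δ p - remainder χ E c s δ p : ℝ) : ℂ)‖
        ≤ M * |t - s| := by
  obtain ⟨D, hD⟩ := exists_abs_remainder_sub_le hχ hρ E
  let J := ∫ p in Metric.closedBall (0 : ℝ × ℝ) (3 * ρ), ‖p‖⁻¹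
  have hJ : 0 ≤ J := integral_nonneg fun p => by positivity
  refine ⟨S * D * (2 * J.toNNReal), fun δ t s hδ ht hs => ?_⟩
  have hint (τ : ℝ) : IntegrableOn (fun p => (√(distSq c τ δ p))⁻¹)
      (Metric.closedBall (c, 0) (2 * ρ)) :=
    integrableOn_inv_sqrt_distSq hδ c τ (isCompact_closedBall _ _)
  have hsupp (p : ℝ × ℝ) (hp : p ∉ Metric.closedBall ((c, 0) : ℝ × ℝ) (2 * ρ)) :
      remainder χ E c t δ p - remainder χ E c s δ p = 0 := by
    simp [remainder_eq_zero hχ E _ δ hp]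
  calc _ ≤ S * ∫ p in Metric.closedBall (c, 0) (2 * ρ),
        D * |t - s| * ((√(distSq c t δ p))⁻¹ + (√(distSq c s δ p))⁻¹) :=
        norm_setIntegral_mul_ofReal_le hUm Metric.isClosed_closedBall.measurableSet S.2 hS hsupp
          (hD δ t s hδ ht hs) (((hint t).add (hint s)).const_mul _)
    _ ≤ S * (D * |t - s| * (J + J)) := by
        rw [integral_const_mul, integral_add (hint t) (hint s)]
        gcongr
        · exact setIntegral_inv_sqrt_distSq_le hδ (by linarith)
        · exact setIntegral_inv_sqrt_distSq_le hδ (by linarith)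
    _ = _ := by
        push_cast [Real.coe_toNNReal J hJ]
        ring

end RemainderEstimate

section Profile

/-- The Laplacian of `log (x² + y² + 1)`, an approximate identity after rescaling. -/
def profile (q : ℝ × ℝ) : ℝ := 4 / (q.1 ^ 2 + q.2 ^ 2 + 1) ^ 2

/-- The mass of `profile` in the half-plane `{0 < σ * x}`. -/
def halfMass (σ : ℝ) : ℝ := ∫ q in {q : ℝ × ℝ | 0 < σ * q.1}, profile q

variable {F G : ℝ × ℝ → ℂ} {c t δ σ : ℝ}

lemma profile_pos (q : ℝ × ℝ) : 0 < profile q := by unfold profile; positivity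

lemma continuous_profile : Continuous profile := by
  unfold profile
  exact continuous_const.div (by fun_prop) fun q => by positivity

lemma integrable_profile : Integrable profile := by
  have h : Integrable fun q : ℝ × ℝ => 4 * ((1 + q.1 ^ 2)⁻¹ * (1 + q.2 ^ 2)⁻¹) :=
    (integrable_inv_one_add_sq.mul_prod integrable_inv_one_add_sq).const_mul 4
  refine h.mono' continuous_profile.aestronglyMeasurable (Eventually.of_forall fun q => ?_)
  rw [Real.norm_of_nonneg (profile_pos q).le, profile, div_eq_mul_inv, ← mul_inv]
  gcongr
  nlinarith [sq_nonneg q.1, sq_nonneg q.2, mul_nonneg (sq_nonneg q.1) (sq_nonneg q.2),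
    sq_nonneg (q.1 ^ 2), sq_nonneg (q.2 ^ 2)]

lemma isOpen_halfPlane (σ : ℝ) : IsOpen {q : ℝ × ℝ | 0 < σ * q.1} :=
  isOpen_lt continuous_const (by fun_prop)

lemma halfMass_pos (hσ : σ ≠ 0) : 0 < halfMass σ := by
  rw [halfMass, setIntegral_pos_iff_support_of_nonneg_ae
    (Eventually.of_forall fun q => (profile_pos q).le) integrable_profile.integrableOn,
    Function.support_eq_univ fun q => (profile_pos q).ne', univ_inter]
  exact (isOpen_halfPlane σ).measure_pos volume ⟨(σ, 0), mul_self_pos.2 hσ⟩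

lemma integral_indicator_halfPlane_mul_profile (σ : ℝ) (z : ℂ) :
    ∫ q : ℝ × ℝ, {q : ℝ × ℝ | 0 < σ * q.1}.indicator (fun _ => z) q * (profile q : ℂ)
      = z * halfMass σ := by
  have hind (q : ℝ × ℝ) : {q : ℝ × ℝ | 0 < σ * q.1}.indicator (fun _ => z) q * (profile q : ℂ)
      = {q : ℝ × ℝ | 0 < σ * q.1}.indicator (fun q => z * profile q) q :=
    (indicator_mul_left _ (fun _ => z) fun q => (profile q : ℂ)).symm
  simp only [hind]
  rw [integral_indicator (isOpen_halfPlane σ).measurableSet, integral_const_mul,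
    integral_complex_ofReal, halfMass]

lemma integral_mul_div_distSq_sq (F : ℝ × ℝ → ℂ) (hδ : 0 < δ) (c t : ℝ) :
    ∫ p, F p * ((4 * δ ^ 2 / distSq c t δ p ^ 2 : ℝ) : ℂ)
      = ∫ q : ℝ × ℝ, F ((c, t) + δ • q) * (profile q : ℂ) := by
  have hkernel (q : ℝ × ℝ) :
      4 * δ ^ 2 / distSq c t δ ((c, t) + δ • q) ^ 2 = (δ ^ 2)⁻¹ * profile q := by
    have hdist : distSq c t δ ((c, t) + δ • q) = δ ^ 2 * (q.1 ^ 2 + q.2 ^ 2 + 1) := by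
      simp only [distSq, Prod.fst_add, Prod.snd_add, Prod.smul_fst, Prod.smul_snd, smul_eq_mul]
      ring
    rw [hdist, profile]
    field_simp
  let H (p : ℝ × ℝ) : ℂ := F p * ((4 * δ ^ 2 / distSq c t δ p ^ 2 : ℝ) : ℂ)
  calc ∫ p, H p = ∫ q, H ((c, t) + q) := (integral_add_left_eq_self H (c, t)).symm
    _ = ((δ ^ 2 : ℝ) : ℂ) * ∫ q, H ((c, t) + δ • q) := by
        have hscale := Measure.integral_comp_smul (volume : Measure (ℝ × ℝ))
          (fun q => H ((c, t) + q)) δ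
        rw [hscale]
        have hδ' : (δ : ℂ) ≠ 0 := by exact_mod_cast hδ.ne'
        simp [hδ', abs_of_pos hδ]
    _ = _ := by
        rw [← integral_const_mul]
        congr 1 with q
        have hδ' : (δ : ℂ) ≠ 0 := by exact_mod_cast hδ.ne'
        simp only [H, hkernel]
        push_cast
        field_simp

lemma tendsto_integral_mul_div_distSq_sq {S : ℝ} (hF : Integrable F) (hS : ∀ p, ‖F p‖ ≤ S)
    (hlim : ∀ q : ℝ × ℝ, Tendsto (fun δ : ℝ => F ((c, t) + δ • q)) (𝓝[>] 0) (𝓝 (G q))) :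
    Tendsto (fun δ => ∫ p, F p * ((4 * δ ^ 2 / distSq c t δ p ^ 2 : ℝ) : ℂ)) (𝓝[>] 0)
      (𝓝 (∫ q, G q * (profile q : ℂ))) := by
  have hrescaled : (fun δ => ∫ p, F p * ((4 * δ ^ 2 / distSq c t δ p ^ 2 : ℝ) : ℂ))
      =ᶠ[𝓝[>] 0] fun δ => ∫ q : ℝ × ℝ, F ((c, t) + δ • q) * (profile q : ℂ) :=
    eventually_mem_nhdsWithin.mono fun δ hδ => integral_mul_div_distSq_sq F hδ c t
  refine Tendsto.congr' hrescaled.symm (tendsto_integral_filter_of_dominated_convergence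
    (fun q => S * profile q) (eventually_mem_nhdsWithin.mono fun δ (hδ : 0 < δ) => ?_)
    (Eventually.of_forall fun δ => Eventually.of_forall fun q => ?_)
    (integrable_profile.const_mul S) (Eventually.of_forall fun q => (hlim q).mul_const _))
  · exact ((hF.comp_add_left (c, t)).comp_smul hδ.ne').aestronglyMeasurable.mul
      (Complex.continuous_ofReal.comp continuous_profile).aestronglyMeasurable
  · rw [norm_mul, Complex.norm_real, Real.norm_of_nonneg (profile_pos q).le]
    exact mul_le_mul_of_nonneg_right (hS _) (profile_pos q).le

lemma IsHalfPlaneNear.tendsto_indicator {U : Set (ℝ × ℝ)} {r : ℝ} {f : ℝ × ℝ → ℂ}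
    (hU : IsHalfPlaneNear U c σ r) (ht : |t| < r) (hf : ContinuousWithinAt f U (c, t))
    (q : ℝ × ℝ) :
    Tendsto (fun δ : ℝ => U.indicator f ((c, t) + δ • q)) (𝓝[>] 0)
      (𝓝 ({q : ℝ × ℝ | 0 < σ * q.1}.indicator (fun _ => f (c, t)) q)) := by
  have hline : Tendsto (fun δ : ℝ => ((c, t) : ℝ × ℝ) + δ • q) (𝓝[>] 0) (𝓝 (c, t)) :=
    (Continuous.tendsto' (by fun_prop) _ _ (by simp)).mono_left nhdsWithin_le_nhds
  have hmem : ∀ᶠ δ : ℝ in 𝓝[>] 0, ((c, t) + δ • q ∈ U ↔ 0 < σ * q.1) := by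
    have hball : ((c, t) : ℝ × ℝ) ∈ Metric.ball ((c, 0) : ℝ × ℝ) r := by
      simpa [Prod.dist_eq, (abs_nonneg t).trans_lt ht] using ht
    filter_upwards [hline.eventually (Metric.isOpen_ball.mem_nhds hball),
      eventually_mem_nhdsWithin] with δ hδr hδ
    rw [hU.mem_iff _ hδr]
    have hfst : σ * (((c, t) + δ • q : ℝ × ℝ).1 - c) = δ * (σ * q.1) := by
      simp only [Prod.fst_add, Prod.smul_fst, smul_eq_mul]
      ring
    rw [hfst, mul_pos_iff_of_pos_left hδ]
  by_cases hq : 0 < σ * q.1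
  · rw [indicator_of_mem (by exact hq)]
    have hmemU : ∀ᶠ δ : ℝ in 𝓝[>] 0, (c, t) + δ • q ∈ U := hmem.mono fun δ h => h.2 hq
    refine (hf.tendsto.comp (tendsto_nhdsWithin_iff.2 ⟨hline, hmemU⟩)).congr' ?_
    exact hmemU.mono fun δ h => (indicator_of_mem h f).symm
  · rw [indicator_of_notMem (by exact hq)]
    exact tendsto_const_nhds.congr' (hmem.mono fun δ h => (indicator_of_notMem (hq ∘ h.1) f).symm)

end Profile

section BoundaryRegularity

variable {U : Set (ℝ × ℝ)} {u : ℝ × ℝ → ℂ} {χ : ℝ × ℝ → ℝ} {c t s δ σ r ρ E : ℝ} {S : ℝ≥0}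

lemma tendsto_integral_mul_cutoff (hUm : MeasurableSet U) (hU : IsHalfPlaneNear U c σ r)
    (hu : MemLp u 2 (volume.restrict U)) (hχ : IsCutoff χ c ρ)
    (hS : ∀ p ∈ U ∩ Metric.closedBall (c, 0) (2 * ρ), ‖u p‖ ≤ S) (htr : |t| < r) (ht : |t| ≤ ρ)
    (hcont : ContinuousWithinAt u U (c, t)) :
    Tendsto (fun δ => ∫ p in U, u p * ((χ p * (4 * δ ^ 2 / distSq c t δ p ^ 2) : ℝ) : ℂ))
      (𝓝[>] 0) (𝓝 (u (c, t) * halfMass σ)) := by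
  let f (p : ℝ × ℝ) : ℂ := u p * (χ p : ℂ)
  have hχ' : Continuous fun p => (χ p : ℂ) := Complex.continuous_ofReal.comp hχ.contDiff.continuous
  have hf : Integrable (U.indicator f) := (integrable_indicator_iff hUm).2
    (hu.integrable_mul (memLp_ofReal_comp hχ.contDiff hχ.hasCompactSupport))
  obtain ⟨A, hA⟩ := hχ.hasCompactSupport.exists_bound_of_continuous hχ.contDiff.continuous
  have hbound (p : ℝ × ℝ) : ‖U.indicator f p‖ ≤ S * A := by
    have hA0 : 0 ≤ A := (norm_nonneg _).trans (hA p)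
    by_cases hp : p ∈ U ∩ tsupport χ
    · rw [indicator_of_mem hp.1, norm_mul, Complex.norm_real]
      exact mul_le_mul (hS p ⟨hp.1, hχ.tsupport_subset hp.2⟩) (hA p) (norm_nonneg _) S.2
    · have hzero : U.indicator f p = 0 := indicator_apply_eq_zero.2 fun hpU => by
        simp [f, image_eq_zero_of_notMem_tsupport fun h => hp ⟨hpU, h⟩]
      rw [hzero, norm_zero]
      positivity
  have hft : f (c, t) = u (c, t) := by
    have hone : χ (c, t) = 1 := hχ.eq_one _ (by
      simpa [Prod.dist_eq, (abs_nonneg t).trans ht] using ht)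
    simp [f, hone]
  have hlim := tendsto_integral_mul_div_distSq_sq hf hbound
    (hU.tendsto_indicator htr (hcont.mul hχ'.continuousWithinAt))
  rw [integral_indicator_halfPlane_mul_profile] at hlim
  change Tendsto _ _ (𝓝 (f (c, t) * halfMass σ)) at hlim
  rw [hft] at hlim
  refine hlim.congr fun δ => ?_
  rw [← integral_indicator hUm]
  congr 1 with p
  by_cases hp : p ∈ U
  · simp only [indicator_of_mem hp, f]
    push_cast
    ring
  · simp only [indicator_of_notMem hp, zero_mul]

lemma contDiff_cutoff_mul_kernel (hχ : IsCutoff χ c ρ) (hδ : 0 < δ) (t : ℝ) :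
    ContDiff ℝ ∞ fun p => χ p * (4 * δ ^ 2 / distSq c t δ p ^ 2) := by
  refine hχ.contDiff.mul (contDiff_const.div ?_ fun p => (pow_pos (distSq_pos hδ c t p) 2).ne')
  unfold distSq
  fun_prop

lemma contDiff_remainder (hχ : IsCutoff χ c ρ) (hδ : 0 < δ) (E t : ℝ) :
    ContDiff ℝ ∞ (remainder χ E c t δ) := by
  have hrem : remainder χ E c t δ = fun p =>
      laplacian (logPotential χ c t δ) p + E * logPotential χ c t δ p
        - χ p * (4 * δ ^ 2 / distSq c t δ p ^ 2) := by
    ext p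
    rw [laplacian_logPotential_add hχ hδ, add_sub_cancel_left]
  have hpot := contDiff_logPotential hχ hδ t
  rw [hrem]
  exact ((contDiff_laplacian hpot).add (contDiff_const.mul hpot)).sub
    (contDiff_cutoff_mul_kernel hχ hδ t)

lemma integral_mul_kernel_sub (hUm : MeasurableSet U) (hU : IsHalfPlaneNear U c σ r)
    (hu : IsNeumannSolution U E u) (hχ : IsCutoff χ c ρ) (hρ : 2 * ρ < r) (hδ : 0 < δ) (t s : ℝ) :
    (∫ p in U, u p * ((χ p * (4 * δ ^ 2 / distSq c t δ p ^ 2) : ℝ) : ℂ))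
        - ∫ p in U, u p * ((χ p * (4 * δ ^ 2 / distSq c s δ p ^ 2) : ℝ) : ℂ)
      = -∫ p in U, u p * ((remainder χ E c t δ p - remainder χ E c s δ p : ℝ) : ℂ) := by
  have hrem_int (τ : ℝ) : IntegrableOn (fun p => u p * (remainder χ E c τ δ p : ℂ)) U :=
    hu.memLp.integrable_mul (memLp_ofReal_comp (contDiff_remainder hχ hδ E τ)
      (HasCompactSupport.intro (isCompact_closedBall _ _) fun p => remainder_eq_zero hχ E τ δ))
  have hker_int (τ : ℝ) :
      IntegrableOn (fun p => u p * ((χ p * (4 * δ ^ 2 / distSq c τ δ p ^ 2) : ℝ) : ℂ)) U :=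
    hu.memLp.integrable_mul (memLp_ofReal_comp (contDiff_cutoff_mul_kernel hχ hδ τ)
      hχ.hasCompactSupport.mul_right)
  have hzero (τ : ℝ) : (∫ p in U, u p * ((χ p * (4 * δ ^ 2 / distSq c τ δ p ^ 2) : ℝ) : ℂ))
      + ∫ p in U, u p * (remainder χ E c τ δ p : ℂ) = 0 := by
    rw [← integral_add (hker_int τ) (hrem_int τ),
      ← integral_mul_add_remainder_eq_zero hUm hU hu hχ hρ hδ τ]
    simp only [Complex.ofReal_add, mul_add]
  simp only [Complex.ofReal_sub, mul_sub]
  rw [integral_sub (hrem_int t) (hrem_int s)]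
  linear_combination hzero t - hzero s

lemma exists_lipschitzOnWith_of_isCutoff (hUm : MeasurableSet U) (hU : IsHalfPlaneNear U c σ r)
    (hu : IsNeumannSolution U E u) (hχ : IsCutoff χ c ρ) (hρ : 0 < ρ) (hρr : 2 * ρ < r)
    (hS : ∀ p ∈ U ∩ Metric.closedBall (c, 0) (2 * ρ), ‖u p‖ ≤ S)
    (hcont : ∀ t, |t| < r → ContinuousWithinAt u U (c, t)) :
    ∃ K, LipschitzOnWith K (fun t => u (c, t)) (Icc (-(ρ / 2)) (ρ / 2)) := by
  obtain ⟨M, hM⟩ := exists_norm_integral_remainder_sub_le hUm hχ hρ E hS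
  have hmass := halfMass_pos hU.ne_zero
  have hlim (t : ℝ) (ht : |t| ≤ ρ / 2) := tendsto_integral_mul_cutoff hUm hU hu.memLp hχ hS
    (by linarith) (by linarith) (hcont t (by linarith))
  refine ⟨M / (halfMass σ).toNNReal, LipschitzOnWith.of_dist_le_mul fun t ht s hs => ?_⟩
  rw [mem_Icc, ← abs_le] at ht hs
  have hle : ‖u (c, t) * halfMass σ - u (c, s) * halfMass σ‖ ≤ M * |t - s| := by
    refine le_of_tendsto ((hlim t ht).sub (hlim s hs)).norm
      (eventually_mem_nhdsWithin.mono fun δ (hδ : 0 < δ) => ?_)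
    rw [integral_mul_kernel_sub hUm hU hu hχ hρr hδ, norm_neg]
    exact hM δ t s hδ ht hs
  rw [← sub_mul, norm_mul, Complex.norm_real, Real.norm_of_nonneg hmass.le] at hle
  rw [dist_eq_norm, Real.dist_eq, NNReal.coe_div, Real.coe_toNNReal _ hmass.le, div_mul_eq_mul_div,
    le_div_iff₀ hmass]
  exact hle

theorem exists_lipschitzOnWith_boundary (hUm : MeasurableSet U) (hr : 0 < r)
    (hU : IsHalfPlaneNear U c σ r) (hu : IsNeumannSolution U E u)
    (hcont : ContinuousOn u (Metric.ball (c, 0) r ∩ {p | 0 ≤ σ * (p.1 - c)})) :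
    ∃ R > 0, ∃ K, LipschitzOnWith K (fun t => u (c, t)) (Icc (-R) R) := by
  obtain ⟨χ, hχ⟩ := exists_isCutoff c (ρ := r / 3) (by positivity)
  have hmem : ∀ p ∈ U ∩ Metric.ball (c, 0) r, 0 ≤ σ * (p.1 - c) :=
    fun p hp => ((hU.mem_iff p hp.2).1 hp.1).le
  have hball : Metric.closedBall ((c, 0) : ℝ × ℝ) (2 * (r / 3)) ⊆ Metric.ball (c, 0) r :=
    Metric.closedBall_subset_ball (by linarith)
  have hcompact : IsCompact
      (Metric.closedBall ((c, 0) : ℝ × ℝ) (2 * (r / 3)) ∩ {p | 0 ≤ σ * (p.1 - c)}) :=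
    (isCompact_closedBall _ _).inter_right (isClosed_le continuous_const (by fun_prop))
  obtain ⟨S, hS⟩ := hcompact.exists_bound_of_continuousOn
    (hcont.mono (inter_subset_inter_left _ hball))
  refine ⟨r / 3 / 2, by positivity, exists_lipschitzOnWith_of_isCutoff (S := S.toNNReal) hUm hU hu
    hχ (by positivity) (by linarith) (fun p hp => ?_) fun t ht => ?_⟩
  · exact (hS p ⟨hp.2, hmem p ⟨hp.1, hball hp.2⟩⟩).trans (le_max_left _ _)
  · have ht_ball : ((c, t) : ℝ × ℝ) ∈ Metric.ball (c, 0) r := by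
      simpa [Prod.dist_eq, hr] using ht
    refine (hcont (c, t) ⟨ht_ball, by simp⟩).mono_of_mem_nhdsWithin ?_
    filter_upwards [self_mem_nhdsWithin,
      mem_nhdsWithin_of_mem_nhds (Metric.isOpen_ball.mem_nhds ht_ball)] with p hpU hp
    exact ⟨hp, hmem p ⟨hpU, hp⟩⟩

end BoundaryRegularity

section Waveguide

variable {Ω : Set (ℝ × ℝ)} {u : ℝ × ℝ → ℂ} {E c σ θ : ℝ} {K₀ K₁ : ℝ≥0} {s : Set ℝ}

lemma isOpen_openCell (hΩ : IsOpen Ω) : IsOpen (openCell Ω) :=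
  hΩ.inter (isOpen_Ioo.prod isOpen_univ)

lemma exists_lipschitzOnWith_cell (hΩ : IsOpen Ω) (hc : (c, 0) ∈ Ω) (hσ : σ ≠ 0)
    (hIoo : ∀ x ∈ Metric.ball c 1, x ∈ Ioo (0 : ℝ) 1 ↔ 0 < σ * (x - c))
    (hIcc : ∀ x ∈ Metric.ball c 1, 0 ≤ σ * (x - c) → x ∈ Icc (0 : ℝ) 1)
    (hu : IsNeumannSolution (openCell Ω) E u) (hcont : ContinuousOn u (cell Ω)) :
    ∃ R > 0, ∃ K, LipschitzOnWith K (fun t => u (c, t)) (Icc (-R) R) := by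
  obtain ⟨r, hr, hball⟩ := Metric.isOpen_iff.1 hΩ _ hc
  have hmemΩ {p : ℝ × ℝ} (hp : p ∈ Metric.ball (c, 0) (min r 1)) : p ∈ Ω :=
    hball (Metric.ball_subset_ball (min_le_left _ _) hp)
  have hfst {p : ℝ × ℝ} (hp : p ∈ Metric.ball (c, 0) (min r 1)) : p.1 ∈ Metric.ball c 1 := by
    have hp1 := Metric.ball_subset_ball (min_le_right r 1) hp
    rw [← ball_prod_same] at hp1
    exact hp1.1
  have hU : IsHalfPlaneNear (openCell Ω) c σ (min r 1) := ⟨hσ, fun p hp => by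
    rw [← hIoo p.1 (hfst hp)]
    exact ⟨fun h => h.2.1, fun h => ⟨hmemΩ hp, h, mem_univ _⟩⟩⟩
  exact exists_lipschitzOnWith_boundary (isOpen_openCell hΩ).measurableSet
    (lt_min hr one_pos) hU hu
    (hcont.mono fun p hp => ⟨hmemΩ hp.1, hIcc p.1 (hfst hp.1) hp.2, mem_univ _⟩)

lemma exists_lipschitzOnWith_left (hΩ : IsOpen Ω) (h0 : (0, 0) ∈ Ω)
    (hu : IsNeumannSolution (openCell Ω) E u) (hcont : ContinuousOn u (cell Ω)) :
    ∃ R > 0, ∃ K, LipschitzOnWith K (fun t => u (0, t)) (Icc (-R) R) := by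
  refine exists_lipschitzOnWith_cell (σ := 1) hΩ h0 one_ne_zero (fun x hx => ?_) (fun x hx h => ?_)
    hu hcont <;> rw [Metric.mem_ball, Real.dist_eq, abs_lt] at hx
  · exact ⟨fun h => by linarith [h.1], fun h => ⟨by linarith, by linarith⟩⟩
  · exact ⟨by linarith, by linarith⟩

lemma exists_lipschitzOnWith_right (hΩ : IsOpen Ω) (h1 : (1, 0) ∈ Ω)
    (hu : IsNeumannSolution (openCell Ω) E u) (hcont : ContinuousOn u (cell Ω)) :
    ∃ R > 0, ∃ K, LipschitzOnWith K (fun t => u (1, t)) (Icc (-R) R) := by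
  refine exists_lipschitzOnWith_cell (σ := -1) hΩ h1 (by norm_num) (fun x hx => ?_)
    (fun x hx h => ?_) hu hcont <;> rw [Metric.mem_ball, Real.dist_eq, abs_lt] at hx
  · exact ⟨fun h => by linarith [h.2], fun h => ⟨by linarith, by linarith⟩⟩
  · exact ⟨by linarith, by linarith⟩

lemma norm_exp_I_mul_ofReal (θ : ℝ) : ‖Complex.exp (Complex.I * θ)‖ = 1 := by
  rw [mul_comm, Complex.norm_exp_ofReal_mul_I]

lemma lipschitzOnWith_uTheta (h₀ : LipschitzOnWith K₀ (fun t => u (0, t)) s)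
    (h₁ : LipschitzOnWith K₁ (fun t => u (1, t)) s) (θ : ℝ) :
    LipschitzOnWith (K₀ + K₁) (uTheta u θ) s := by
  have h := h₀.sub ((lipschitzWith_smul (Complex.exp (Complex.I * θ))).comp_lipschitzOnWith h₁)
  have hexp : ‖Complex.exp (Complex.I * θ)‖₊ = 1 := NNReal.eq (norm_exp_I_mul_ofReal θ)
  rwa [hexp, one_mul] at h

lemma norm_uTheta_le (u : ℝ × ℝ → ℂ) (θ y : ℝ) : ‖uTheta u θ y‖ ≤ ‖u (0, y)‖ + ‖u (1, y)‖ := by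
  refine (norm_sub_le _ _).trans_eq ?_
  rw [norm_mul, norm_exp_I_mul_ofReal, one_mul]

lemma norm_le_of_lipschitzOnWith {f : ℝ → ℂ} {ε : ℝ} {K : ℝ≥0} (hε : 0 ≤ ε) (hε1 : ε ≤ 1)
    (hf : LipschitzOnWith K f (Icc (-ε) ε)) {y : ℝ} (hy : y ∈ Icc (-ε) ε) : ‖f y‖ ≤ ‖f 0‖ + K := by
  have hdist := hf.norm_sub_le hy ⟨neg_nonpos.2 hε, hε⟩
  rw [sub_zero, Real.norm_eq_abs] at hdist
  have hK : K * |y| ≤ K := mul_le_of_le_one_right K.2 ((abs_le.2 hy).trans hε1)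
  linarith [norm_sub_norm_le (f y) (f 0)]

end Waveguide

end CrackedWaveguide

end

open CrackedWaveguide in
theorem proposition2_general (Ω : Set (ℝ × ℝ)) (hΩ : IsOpen Ω) (h0 : (0, 0) ∈ Ω)
    (h1 : (1, 0) ∈ Ω) (E : ℝ) (u : ℝ × ℝ → ℂ) (hu : IsNeumannSolution (openCell Ω) E u)
    (hcont : ContinuousOn u (cell Ω)) :
    ∃ ε₀ C A : ℝ, 0 < ε₀ ∧ ε₀ < 1 ∧ 0 < C ∧ 0 < A ∧ ∀ ε : ℝ, 0 < ε → ε < ε₀ →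
      Set.BijOn (L ε) Set.univ (Y ε) ∧
      ∀ θ : ℝ,
        uThetaRestrict u θ ε ∈ Y ε ∧
        ‖pairing ε (Linv ε (uThetaRestrict u θ ε)) (uTheta u θ)
            - ((‖uTheta u θ 0‖ ^ 2 / Real.log ε : ℝ) : ℂ)‖ ≤ C / |Real.log ε| ^ 2 ∧
        ∀ B : X ε →L[ℂ] X ε,
          ‖pairing ε (B (Linv ε (uThetaRestrict u θ ε))) (uTheta u θ)‖
            ≤ A * ‖B‖ / |Real.log ε| := by
  obtain ⟨R₀, hR₀, K₀, hlip₀⟩ := exists_lipschitzOnWith_left hΩ h0 hu hcont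
  obtain ⟨R₁, hR₁, K₁, hlip₁⟩ := exists_lipschitzOnWith_right hΩ h1 hu hcont
  let K : NNReal := K₀ + K₁
  let S : ℝ := ‖u (0, 0)‖ + ‖u (1, 0)‖ + K
  refine ⟨min (min R₀ R₁) (1 / 2), S ^ 2 + 168 * S * K + 1, 2 * S * (S + 20 * K) + 1, by positivity,
    (min_le_right _ _).trans_lt one_half_lt_one, by positivity, by positivity, fun ε hε hε₀ => ?_⟩
  obtain ⟨⟨hεR₀, hεR₁⟩, hε_half⟩ := by simpa only [lt_min_iff] using hε₀
  have hε1 : ε < 1 := hε_half.trans one_half_lt_one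
  refine ⟨bijOn_L hε (by linarith), fun θ => ?_⟩
  have hlip : LipschitzOnWith K (uTheta u θ) (Set.Icc (-ε) ε) := lipschitzOnWith_uTheta
    (hlip₀.mono (Set.Icc_subset_Icc (by linarith) hεR₀.le))
    (hlip₁.mono (Set.Icc_subset_Icc (by linarith) hεR₁.le)) θ
  have hS (y : ℝ) (hy : y ∈ Set.Icc (-ε) ε) : ‖uTheta u θ y‖ ≤ S :=
    (norm_le_of_lipschitzOnWith hε.le hε1.le hlip hy).trans
      (add_le_add_left (norm_uTheta_le u θ 0) _)
  refine ⟨domRestrict_mem_Y hε hlip, (norm_pairing_Linv_sub_le hε hε1 hlip hS).trans ?_,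
    fun B => (norm_pairing_apply_Linv_le hε hε1 hlip hS B).trans ?_⟩
  · gcongr ?_ / _; linarith
  · gcongr ?_ * _ / _; linarith

open CrackedWaveguide in
theorem proposition2 (Ω : Set (ℝ × ℝ)) (hΩ : IsWaveguide Ω) (E : ℝ) (u : ℝ × ℝ → ℂ)
    (hu : IsNeumannEigenfunction (openCell Ω) E u) (hcont : ContinuousOn u (cell Ω)) :
    ∃ ε₀ C A : ℝ, 0 < ε₀ ∧ ε₀ < 1 ∧ 0 < C ∧ 0 < A ∧ ∀ ε : ℝ, 0 < ε → ε < ε₀ →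
      Set.BijOn (L ε) Set.univ (Y ε) ∧
      ∀ θ : ℝ,
        uThetaRestrict u θ ε ∈ Y ε ∧
        ‖pairing ε (Linv ε (uThetaRestrict u θ ε)) (uTheta u θ)
            - ((‖uTheta u θ 0‖ ^ 2 / Real.log ε : ℝ) : ℂ)‖ ≤ C / |Real.log ε| ^ 2 ∧
        ∀ B : X ε →L[ℂ] X ε,
          ‖pairing ε (B (Linv ε (uThetaRestrict u θ ε))) (uTheta u θ)‖
            ≤ A * ‖B‖ / |Real.log ε| :=
  proposition2_general Ω hΩ.isOpen (by simpa using hΩ.window_mem 0)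
    (by simpa using hΩ.window_mem 1) E u hu.2 hcont
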